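/- Let $q\in\mathbb{C}$ with $0<|q|<1$ and put $\zeta=q/\overline{q}$. Let $\mathrm{C}(\mathrm{SU}_q(2))$ be the universal unital $\mathrm{C}^*$-algebra generated by two elements $\alpha,\gamma$ subject to $$\alpha^*\alpha+\gamma^*\gamma=1,\quad \alpha\alpha^*+|q|^2\gamma^*\gamma=1,\quad \alpha\gamma=\overline{q}\,\gamma\alpha,\quad \gamma\gamma^*=\gamma^*\gamma,$$ with the action of the circle $\mathbb{T}$ given by $\alpha\mapsto 1\otimes\alpha$, $\gamma\mapsto z\otimes\gamma\in\mathrm{C}(\mathbb{T})\otimes\mathrm{C}(\mathrm{SU}_q(2))$, where $z$ is the canonical generator of $\mathrm{C}(\mathbb{T})$. For unital $\mathrm{C}^*$-algebras $A,B$ with actions of $\mathbb{T}$ let $A\boxtimes_\zeta B$ be the closed linear span of $j_1(A)j_2(B)$ in the minimal tensor product $\mathrm{C}(\mathbb{T}^2_\zeta)\otimes A\otimes B$, where $\mathrm{C}(\mathbb{T}^2_\zeta)$ is the universal $\mathrm{C}^*$-algebra generated by unitaries $u,v$ with $uv=\zeta vu$, and $j_1,j_2$ are the unital $*$-homomorphisms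 with $j_1(a)=u^n\otimes a\otimes 1$ for $a$ homogeneous of degree $n$ (that is, sent to $z^n\otimes a$ by the action) and $j_2(b)=v^m\otimes 1\otimes b$ for $b$ homogeneous of degree $m$. For equivariant unital $*$-homomorphisms $\Phi,\Psi$ let $\Phi\boxtimes_\zeta\Psi$ be the $*$-homomorphism with $j_1(a)j_2(b)\mapsto j_1(\Phi(a))j_2(\Psi(b))$. Let $\Delta:\mathrm{C}(\mathrm{SU}_q(2))\to\mathrm{C}(\mathrm{SU}_q(2))\boxtimes_\zeta\mathrm{C}(\mathrm{SU}_q(2))$ be the unital $*$-homomorphism with $$\Delta(\alpha)=j_1(\alpha)j_2(\alpha)-q\,j_1(\gamma^*)j_2(\gamma),\qquad \Delta(\gamma)=j_1(\gamma)j_2(\alpha)+j_1(\alpha^*)j_2(\gamma),$$ and let $\pi:\mathrm{C}(\mathrm{SU}_q(2))\to\mathrm{C}(\mathbb{T})$ be the unital $*$-homomorphism with $\pi(\alpha)=z$, $\pi(\gamma)=0$, where $\mathbb{T}$ acts trivially on $\mathrm{C}(\mathbb{T})$; so $\mathrm{C}(\mathrm{SU}_q(2))\boxtimes_\zeta\mathrm{C}(\mathbb{T})=\mathrm{C}(\mathrm{SU}_q(2))\otimes\mathrm{C}(\mathbb{T})$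 with $j_1(a)=a\otimes 1$. Define the algebra of functions on the quotient sphere $\mathrm{SU}_q(2)/\mathbb{T}$ by $$\mathrm{C}(\mathbb{S}^2_q)=\bigl\{a\in\mathrm{C}(\mathrm{SU}_q(2)) : (\mathrm{id}\boxtimes_\zeta\pi)\Delta(a)=a\otimes 1\bigr\}.$$ Then $\mathrm{C}(\mathbb{S}^2_q)$ is the closed unital $*$-subalgebra of $\mathrm{C}(\mathrm{SU}_q(2))$ generated by $\alpha\gamma^*$ and $\gamma^*\gamma$. Moreover, the generators $A=\gamma^*\gamma$ and $B=\alpha\gamma^*$ satisfy the relations of the standard Podleś sphere for the parameter $|q|$: $$B^*B=A-A^2,\qquad BB^*=|q|^2A-|q|^4A^2,\qquad BA=|q|^2AB,\qquad A^*=A.$$ -/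

import Mathlib

open scoped TensorProduct ComplexConjugate

noncomputable section

namespace BraidedSU2

section Completion

theorem continuous_hom {A B : Type} [CStarAlgebra A] [CStarAlgebra B] (f : A →⋆ₐ[ℂ] B) :
    Continuous f :=
  AddMonoidHomClass.continuous_of_bound f 1 fun x => by
    rw [one_mul]; exact NonUnitalStarAlgHom.norm_apply_le f x

/-- `p` is a C*-seminorm on the complex unital *-algebra `F`. -/
structure IsCStarSeminorm {F : Type} [Ring F] [StarRing F] [Algebra ℂ F] (p : F → ℝ) : Prop where
  nonneg : ∀ x, 0 ≤ p x
  add_le : ∀ x y, p (x + y) ≤ p x + p y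
  smul : ∀ (c : ℂ) x, p (c • x) = ‖c‖ * p x
  mul_le : ∀ x y, p (x * y) ≤ p x * p y
  star_mul_self : ∀ x, p (star x * x) = p x * p x

variable {F : Type} [Ring F] [StarRing F] [Algebra ℂ F]

namespace IsCStarSeminorm

variable {p : F → ℝ}

theorem zero (hp : IsCStarSeminorm p) : p 0 = 0 := by simpa using hp.smul 0 0

theorem neg (hp : IsCStarSeminorm p) (x : F) : p (-x) = p x := by simpa using hp.smul (-1) x

theorem le_star (hp : IsCStarSeminorm p) (x : F) : p x ≤ p (star x) := by
  have h1 := hp.star_mul_self x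
  have h2 := hp.mul_le (star x) x
  rcases (hp.nonneg x).eq_or_lt with h | h
  · rw [← h]; exact hp.nonneg _
  · nlinarith

theorem star (hp : IsCStarSeminorm p) (x : F) : p (Star.star x) = p x :=
  le_antisymm (by simpa using hp.le_star (Star.star x)) (hp.le_star x)

end IsCStarSeminorm

/-- The pointwise supremum of a pointwise bounded family of C*-seminorms is a C*-seminorm. -/
theorem isCStarSeminorm_sSup (S : Set (F → ℝ)) (hS : ∀ p ∈ S, IsCStarSeminorm p)
    (hb : ∀ x, BddAbove ((fun p : F → ℝ => p x) '' S)) :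
    IsCStarSeminorm (fun x => sSup ((fun p : F → ℝ => p x) '' S)) := by
  have hle : ∀ p ∈ S, ∀ x, p x ≤ sSup ((fun p : F → ℝ => p x) '' S) := fun p hp x =>
    le_csSup (hb x) ⟨p, hp, rfl⟩
  have hnn : ∀ x, 0 ≤ sSup ((fun p : F → ℝ => p x) '' S) := fun x =>
    Real.sSup_nonneg (by rintro _ ⟨p, hp, rfl⟩; exact (hS p hp).nonneg x)
  refine ⟨hnn, fun x y => ?_, fun c x => ?_, fun x y => ?_, fun x => ?_⟩
  · refine Real.sSup_le ?_ (add_nonneg (hnn x) (hnn y))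
    rintro _ ⟨p, hp, rfl⟩
    exact ((hS p hp).add_le x y).trans (add_le_add (hle p hp x) (hle p hp y))
  · have h1 : ∀ (c : ℂ) x, sSup ((fun p : F → ℝ => p (c • x)) '' S) ≤
        ‖c‖ * sSup ((fun p : F → ℝ => p x) '' S) := fun c x => by
      refine Real.sSup_le ?_ (mul_nonneg (norm_nonneg c) (hnn x))
      rintro _ ⟨p, hp, rfl⟩
      simp only [(hS p hp).smul]
      exact mul_le_mul_of_nonneg_left (hle p hp x) (norm_nonneg c)
    refine le_antisymm (h1 c x) ?_
    rcases eq_or_ne c 0 with rfl | hc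
    · simpa using hnn (0 : F)
    · have := h1 c⁻¹ (c • x)
      rw [norm_inv, inv_smul_smul₀ hc] at this
      have hc' : 0 < ‖c‖ := norm_pos_iff.2 hc
      calc _ ≤ ‖c‖ * (‖c‖⁻¹ * _) := mul_le_mul_of_nonneg_left this hc'.le
        _ = _ := by field_simp
  · refine Real.sSup_le ?_ (mul_nonneg (hnn x) (hnn y))
    rintro _ ⟨p, hp, rfl⟩
    exact ((hS p hp).mul_le x y).trans
      (mul_le_mul (hle p hp x) (hle p hp y) ((hS p hp).nonneg y) (hnn x))
  · refine le_antisymm (Real.sSup_le ?_ (mul_nonneg (hnn x) (hnn x))) ?_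
    · rintro _ ⟨p, hp, rfl⟩
      simp only [(hS p hp).star_mul_self]
      exact mul_le_mul (hle p hp x) (hle p hp x) ((hS p hp).nonneg x) (hnn x)
    · have h : sSup ((fun p : F → ℝ => p x) '' S) ≤
          √(sSup ((fun p : F → ℝ => p (star x * x)) '' S)) := by
        refine Real.sSup_le ?_ (Real.sqrt_nonneg _)
        rintro _ ⟨p, hp, rfl⟩
        refine Real.le_sqrt_of_sq_le ?_
        rw [sq, ← (hS p hp).star_mul_self]
        exact hle p hp _
      calc _ ≤ √(sSup ((fun p : F → ℝ => p (star x * x)) '' S)) *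
            √(sSup ((fun p : F → ℝ => p (star x * x)) '' S)) :=
            mul_le_mul h h (hnn x) (Real.sqrt_nonneg _)
        _ = _ := Real.mul_self_sqrt (hnn _)


/-- A *-algebra `F`, regarded as a seminormed *-algebra through the C*-seminorm `p`. -/
def Pre (p : F → ℝ) (_ : IsCStarSeminorm p) : Type := F

variable {p : F → ℝ} {hp : IsCStarSeminorm p}

instance : SeminormedRing (Pre p hp) :=
  letI : Ring (Pre p hp) := inferInstanceAs (Ring F)
  RingSeminorm.toSeminormedRing
    { toFun := p
      map_zero' := hp.zero
      add_le' := hp.add_le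
      neg' := hp.neg
      mul_le' := hp.mul_le }

instance : StarRing (Pre p hp) := inferInstanceAs (StarRing F)

instance : Algebra ℂ (Pre p hp) := inferInstanceAs (Algebra ℂ F)

instance : NormedAlgebra ℂ (Pre p hp) where
  norm_smul_le c x := (hp.smul c x).le

instance [StarModule ℂ F] : StarModule ℂ (Pre p hp) := inferInstanceAs (StarModule ℂ F)

instance : NormedStarGroup (Pre p hp) where
  norm_star_le x := (hp.star x).le

/-- The C*-algebra obtained from a *-algebra `F` by completing it (after dividing out the null
ideal) with respect to the C*-seminorm `p`. -/
def CStarCompletion (p : F → ℝ) (hp : IsCStarSeminorm p) : Type :=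
  UniformSpace.Completion (Pre p hp)

namespace CStarCompletion

open UniformSpace

instance : NormedRing (CStarCompletion p hp) :=
  inferInstanceAs (NormedRing (Completion (Pre p hp)))

instance : CompleteSpace (CStarCompletion p hp) :=
  inferInstanceAs (CompleteSpace (Completion (Pre p hp)))

instance : Algebra ℂ (CStarCompletion p hp) :=
  inferInstanceAs (Algebra ℂ (Completion (Pre p hp)))

instance : NormedAlgebra ℂ (CStarCompletion p hp) where
  norm_smul_le c x := norm_smul_le (α := ℂ) (β := Completion (Pre p hp)) c x

/-- The canonical map with dense range. -/
def coe (p : F → ℝ) (hp : IsCStarSeminorm p) : F →+* CStarCompletion p hp :=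
  (Completion.coeRingHom : Pre p hp →+* Completion (Pre p hp))

theorem denseRange_coe : DenseRange (coe p hp) :=
  (Completion.denseRange_coe : DenseRange ((↑) : Pre p hp → Completion (Pre p hp)))

theorem norm_coe (x : F) : ‖coe p hp x‖ = p x :=
  (Completion.norm_coe (E := Pre p hp) x)

theorem coe_smul (c : ℂ) (x : F) : coe p hp (c • x) = c • coe p hp x :=
  Completion.coe_smul (X := Pre p hp) c x

instance : Star (CStarCompletion p hp) where
  star := Completion.map (star : Pre p hp → Pre p hp)

theorem continuous_star' : Continuous (star : CStarCompletion p hp → CStarCompletion p hp) :=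
  Completion.continuous_map (f := (star : Pre p hp → Pre p hp))

theorem coe_star (x : F) : coe p hp (star x) = star (coe p hp x) :=
  (Completion.map_coe (f := (star : Pre p hp → Pre p hp))
    (starNormedAddGroupHom (E := Pre p hp)).uniformContinuous x).symm

instance : StarRing (CStarCompletion p hp) where
  star_involutive x := by
    refine denseRange_coe.induction_on (p := fun x => star (star x) = x) x
      (isClosed_eq (continuous_star'.comp continuous_star') continuous_id) fun a => ?_
    rw [← coe_star, ← coe_star, star_star]
  star_mul x y := by
    refine denseRange_coe.induction_on₂ (p := fun x y => star (x * y) = star y * star x)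
      (isClosed_eq (continuous_star'.comp continuous_mul)
        ((continuous_star'.comp continuous_snd).mul (continuous_star'.comp continuous_fst)))
      (fun a b => ?_) x y
    rw [← map_mul, ← coe_star, star_mul, map_mul, coe_star, coe_star]
  star_add x y := by
    refine denseRange_coe.induction_on₂ (p := fun x y => star (x + y) = star x + star y)
      (isClosed_eq (continuous_star'.comp continuous_add)
        ((continuous_star'.comp continuous_fst).add (continuous_star'.comp continuous_snd)))
      (fun a b => ?_) x y
    rw [← map_add, ← coe_star, star_add, map_add, coe_star, coe_star]

instance : CStarRing (CStarCompletion p hp) where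
  norm_mul_self_le x := by
    refine denseRange_coe.induction_on (p := fun x => ‖x‖ * ‖x‖ ≤ ‖star x * x‖) x
      (isClosed_le (by fun_prop) ((continuous_star'.mul continuous_id).norm)) fun a => ?_
    rw [← coe_star, ← map_mul, norm_coe, norm_coe, hp.star_mul_self]

instance [StarModule ℂ F] : StarModule ℂ (CStarCompletion p hp) where
  star_smul c x := by
    refine denseRange_coe.induction_on (p := fun x => star (c • x) = star c • star x) x
      (isClosed_eq (continuous_star'.comp (continuous_const_smul c))
        (continuous_star'.const_smul (star c))) fun a => ?_
    rw [← coe_smul, ← coe_star, star_smul, coe_smul, coe_star]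

instance [StarModule ℂ F] : CStarAlgebra (CStarCompletion p hp) where

/-- The canonical *-homomorphism of a *-algebra into its completion. -/
def of (p : F → ℝ) (hp : IsCStarSeminorm p) : F →⋆ₐ[ℂ] CStarCompletion p hp where
  toRingHom := coe p hp
  commutes' c := by
    change coe p hp (algebraMap ℂ F c) = _
    rw [Algebra.algebraMap_eq_smul_one, coe_smul, map_one, ← Algebra.algebraMap_eq_smul_one]
  map_star' := coe_star

theorem denseRange_of : DenseRange (of p hp) := denseRange_coe

theorem norm_of (x : F) : ‖of p hp x‖ = p x := norm_coe x

/-- A *-homomorphism out of `F`, as a ring homomorphism out of the seminormed ring `Pre p hp`. -/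
def preHom {B : Type} [CStarAlgebra B] (hp : IsCStarSeminorm p) (f : F →⋆ₐ[ℂ] B) :
    Pre p hp →+* B := (f : F →+* B)

theorem continuous_preHom {B : Type} [CStarAlgebra B] (f : F →⋆ₐ[ℂ] B)
    (hf : ∀ x, ‖f x‖ ≤ p x) : Continuous (preHom hp f) :=
  AddMonoidHomClass.continuous_of_bound (preHom hp f) 1
    (fun x => by rw [one_mul]; exact hf x)

/-- A *-homomorphism into a C*-algebra which is dominated by the seminorm `p` extends to the
completion. -/
def lift {B : Type} [CStarAlgebra B] (f : F →⋆ₐ[ℂ] B) (hf : ∀ x, ‖f x‖ ≤ p x) :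
    CStarCompletion p hp →⋆ₐ[ℂ] B :=
  have hc : Continuous (preHom hp f) := continuous_preHom f hf
  let g : CStarCompletion p hp →+* B := Completion.extensionHom (preHom hp f) hc
  have hg : ∀ x, g (of p hp x) = f x := fun x => Completion.extensionHom_coe (preHom hp f) hc x
  have hgc : Continuous g := Completion.continuous_extension
  { toRingHom := g
    commutes' := fun c => by
      change g (algebraMap ℂ _ c) = _
      rw [← AlgHomClass.commutes (of p hp), hg, AlgHomClass.commutes]
    map_star' := fun x => by
      change g (star x) = star (g x)
      refine denseRange_of.induction_on (p := fun x => g (star x) = star (g x)) x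
        (isClosed_eq (hgc.comp continuous_star) hgc.star) fun a => ?_
      rw [← map_star, hg, hg, map_star] }

@[simp]
theorem lift_of {B : Type} [CStarAlgebra B] (f : F →⋆ₐ[ℂ] B) (hf : ∀ x, ‖f x‖ ≤ p x) (x : F) :
    lift (hp := hp) f hf (of p hp x) = f x :=
  Completion.extensionHom_coe (preHom hp f) (continuous_preHom f hf) x

end CStarCompletion

end Completion

section Universal

/-- The free complex unital *-algebra on the set `X`: noncommutative polynomials in the letters
`(x, false)`, standing for `x`, and `(x, true)`, standing for `x*`. -/
def FreeStar (X : Type) : Type := FreeAlgebra ℂ (X × Bool)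

namespace FreeStar

variable {X : Type}

instance : Ring (FreeStar X) := inferInstanceAs (Ring (FreeAlgebra ℂ (X × Bool)))

instance : Algebra ℂ (FreeStar X) := inferInstanceAs (Algebra ℂ (FreeAlgebra ℂ (X × Bool)))

/-- The letters of the free *-algebra. -/
def letter (y : X × Bool) : FreeStar X := FreeAlgebra.ι ℂ y

/-- The generators of the free *-algebra. -/
def gen (x : X) : FreeStar X := letter (x, false)

@[elab_as_elim]
theorem induction {P : FreeStar X → Prop} (h0 : ∀ c : ℂ, P (algebraMap ℂ (FreeStar X) c))
    (h1 : ∀ y, P (letter y)) (hm : ∀ a b, P a → P b → P (a * b))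
    (ha : ∀ a b, P a → P b → P (a + b)) (a : FreeStar X) : P a :=
  FreeAlgebra.induction ℂ (X × Bool) (motive := P) h0 h1 hm ha a

/-- The opposite of the free *-algebra, with the conjugate scalar multiplication. -/
@[reducible]
def conjAlgebra : Algebra ℂ (FreeStar X)ᵐᵒᵖ :=
  ((algebraMap ℂ (FreeStar X)ᵐᵒᵖ).comp (starRingEnd ℂ)).toAlgebra' fun c x =>
    Algebra.commutes (starRingEnd ℂ c) x

/-- The conjugate linear antimultiplicative map with `x ↦ x*` and `x* ↦ x`. -/
def starAux : FreeStar X →+* (FreeStar X)ᵐᵒᵖ :=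
  letI : Algebra ℂ (FreeStar X)ᵐᵒᵖ := conjAlgebra
  (FreeAlgebra.lift ℂ (fun y : X × Bool => MulOpposite.op (letter (y.1, !y.2))) :
    FreeAlgebra ℂ (X × Bool) →ₐ[ℂ] (FreeStar X)ᵐᵒᵖ).toRingHom

theorem starAux_letter (y : X × Bool) :
    starAux (letter y) = MulOpposite.op (letter (y.1, !y.2)) := by
  let _ : Algebra ℂ (FreeStar X)ᵐᵒᵖ := conjAlgebra
  exact FreeAlgebra.lift_ι_apply (R := ℂ)
    (fun y : X × Bool => MulOpposite.op (letter (y.1, !y.2))) y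

theorem starAux_algebraMap (c : ℂ) :
    starAux (algebraMap ℂ (FreeStar X) c) = MulOpposite.op (algebraMap ℂ (FreeStar X) (conj c)) := by
  let _ : Algebra ℂ (FreeStar X)ᵐᵒᵖ := conjAlgebra
  exact AlgHom.commutes (FreeAlgebra.lift ℂ
    (fun y : X × Bool => MulOpposite.op (letter (y.1, !y.2))) :
    FreeAlgebra ℂ (X × Bool) →ₐ[ℂ] (FreeStar X)ᵐᵒᵖ) c

instance : StarRing (FreeStar X) where
  star x := (starAux x).unop
  star_involutive x := by
    induction x using induction with
    | h0 c => simp [starAux_algebraMap]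
    | h1 y => simp [starAux_letter]
    | hm a b ha hb => simp only [map_mul, MulOpposite.unop_mul, ha, hb]
    | ha a b ha hb => simp only [map_add, MulOpposite.unop_add, ha, hb]
  star_mul x y := by simp
  star_add x y := by simp

theorem star_letter (y : X × Bool) : star (letter y) = letter (y.1, !y.2) :=
  congrArg MulOpposite.unop (starAux_letter y)

theorem star_algebraMap (c : ℂ) :
    star (algebraMap ℂ (FreeStar X) c) = algebraMap ℂ (FreeStar X) (conj c) :=
  congrArg MulOpposite.unop (starAux_algebraMap c)

instance : StarModule ℂ (FreeStar X) where
  star_smul c x := by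
    rw [Algebra.smul_def, Algebra.smul_def, star_mul, star_algebraMap, ← Algebra.commutes]
    rfl

variable {A : Type} [CStarAlgebra A]

/-- Evaluation of noncommutative *-polynomials at a family of elements of a C*-algebra. -/
def evalAlgHom (a : X → A) : FreeStar X →ₐ[ℂ] A :=
  (FreeAlgebra.lift ℂ (fun y : X × Bool => if y.2 then star (a y.1) else a y.1) :
    FreeAlgebra ℂ (X × Bool) →ₐ[ℂ] A)

theorem evalAlgHom_letter (a : X → A) (y : X × Bool) :
    evalAlgHom a (letter y) = if y.2 then star (a y.1) else a y.1 :=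
  FreeAlgebra.lift_ι_apply (R := ℂ) _ y

/-- Evaluation of noncommutative *-polynomials, as a *-homomorphism. -/
def eval (a : X → A) : FreeStar X →⋆ₐ[ℂ] A where
  toAlgHom := evalAlgHom a
  map_star' x := by
    change evalAlgHom a (star x) = star (evalAlgHom a x)
    induction x using induction with
    | h0 c => rw [star_algebraMap, AlgHom.commutes, AlgHom.commutes]; exact algebraMap_star_comm c
    | h1 y =>
      obtain ⟨x, b⟩ := y
      rw [star_letter, evalAlgHom_letter, evalAlgHom_letter]
      cases b <;> simp
    | hm a b ha hb => rw [star_mul, map_mul, map_mul, star_mul, ha, hb]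
    | ha a b ha hb => rw [star_add, map_add, map_add, star_add, ha, hb]

@[simp]
theorem eval_gen (a : X → A) (x : X) : eval a (gen x) = a x :=
  (evalAlgHom_letter a (x, false)).trans (by simp)

theorem eval_letter (a : X → A) (y : X × Bool) :
    eval a (letter y) = if y.2 then star (a y.1) else a y.1 :=
  evalAlgHom_letter a y

end FreeStar

variable {X : Type}

/-- The elements `a x` of a C*-algebra satisfy the relations `r = 0`, for `r` in the set `R` of
*-polynomials. -/
def Satisfies (R : Set (FreeStar X)) {A : Type} [CStarAlgebra A] (a : X → A) : Prop :=
  ∀ r ∈ R, FreeStar.eval a r = 0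

/-- The relations `R` bound the norms of the generators in all representations in C*-algebras, so
that they admit a universal C*-algebra. -/
def IsBoundedRel (R : Set (FreeStar X)) : Prop :=
  ∀ x : X, ∃ C : ℝ, ∀ (A : Type) [CStarAlgebra A] (a : X → A), Satisfies R a → ‖a x‖ ≤ C

/-- The C*-seminorms on the free *-algebra that come from families of elements of C*-algebras
satisfying the relations `R`. -/
def repSeminorms (R : Set (FreeStar X)) : Set (FreeStar X → ℝ) :=
  {p | ∃ (A : Type) (_ : CStarAlgebra A) (a : X → A),
    Satisfies R a ∧ p = fun x => ‖FreeStar.eval a x‖}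

theorem norm_algebraMap_le {A : Type} [CStarAlgebra A] (c : ℂ) : ‖algebraMap ℂ A c‖ ≤ ‖c‖ := by
  nontriviality A
  exact (norm_algebraMap' A c).le

theorem isCStarSeminorm_of_hom {F A : Type} [Ring F] [StarRing F] [Algebra ℂ F] [CStarAlgebra A]
    (f : F →⋆ₐ[ℂ] A) : IsCStarSeminorm (fun x => ‖f x‖) where
  nonneg _ := norm_nonneg _
  add_le x y := by simpa only [map_add] using norm_add_le _ _
  smul c x := by simp only [map_smul, norm_smul]
  mul_le x y := by simpa only [map_mul] using norm_mul_le _ _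
  star_mul_self x := by simp only [map_mul, map_star, CStarRing.norm_star_mul_self]

theorem isCStarSeminorm_of_mem_repSeminorms {R : Set (FreeStar X)} :
    ∀ p ∈ repSeminorms R, IsCStarSeminorm p := by
  rintro _ ⟨A, _, a, _, rfl⟩
  exact isCStarSeminorm_of_hom _

theorem bddAbove_repSeminorms {R : Set (FreeStar X)} (hR : IsBoundedRel R) (x : FreeStar X) :
    BddAbove ((fun p : FreeStar X → ℝ => p x) '' repSeminorms R) := by
  suffices h : ∃ C : ℝ, ∀ (A : Type) [CStarAlgebra A] (a : X → A), Satisfies R a →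
      ‖FreeStar.eval a x‖ ≤ C by
    obtain ⟨C, hC⟩ := h
    refine ⟨C, ?_⟩
    rintro _ ⟨_, ⟨A, _, a, ha, rfl⟩, rfl⟩
    exact hC A a ha
  induction x using FreeStar.induction with
  | h0 c =>
    refine ⟨‖c‖, fun A _ a _ => ?_⟩
    rw [AlgHomClass.commutes]
    exact norm_algebraMap_le c
  | h1 y =>
    obtain ⟨C, hC⟩ := hR y.1
    refine ⟨C, fun A _ a ha => ?_⟩
    rw [FreeStar.eval_letter]
    split_ifs
    · rw [norm_star]; exact hC A a ha
    · exact hC A a ha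
  | hm u v hu hv =>
    obtain ⟨C, hC⟩ := hu
    obtain ⟨D, hD⟩ := hv
    refine ⟨C * D, fun A _ a ha => ?_⟩
    rw [map_mul]
    exact (norm_mul_le _ _).trans (mul_le_mul (hC A a ha) (hD A a ha) (norm_nonneg _)
      ((norm_nonneg _).trans (hC A a ha)))
  | ha u v hu hv =>
    obtain ⟨C, hC⟩ := hu
    obtain ⟨D, hD⟩ := hv
    refine ⟨C + D, fun A _ a ha => ?_⟩
    rw [map_add]
    exact (norm_add_le _ _).trans (add_le_add (hC A a ha) (hD A a ha))

/-- The universal C*-seminorm for the relations `R`. -/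
def univSeminorm (R : Set (FreeStar X)) (x : FreeStar X) : ℝ :=
  sSup ((fun p : FreeStar X → ℝ => p x) '' repSeminorms R)

theorem isCStarSeminorm_univSeminorm {R : Set (FreeStar X)} (hR : IsBoundedRel R) :
    IsCStarSeminorm (univSeminorm R) :=
  isCStarSeminorm_sSup _ isCStarSeminorm_of_mem_repSeminorms (bddAbove_repSeminorms hR)

/-- The universal unital C*-algebra generated by the elements of `X` subject to the relations `R`:
the completion of the free *-algebra in the largest C*-seminorm which comes from a family of
elements of a C*-algebra satisfying the relations. -/
def UnivCStar (R : Set (FreeStar X)) (hR : IsBoundedRel R) : Type :=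
  CStarCompletion (univSeminorm R) (isCStarSeminorm_univSeminorm hR)

namespace UnivCStar

variable {R : Set (FreeStar X)} {hR : IsBoundedRel R}

instance : CStarAlgebra (UnivCStar R hR) :=
  inferInstanceAs (CStarAlgebra (CStarCompletion _ _))

/-- The canonical map of the free *-algebra into the universal C*-algebra. -/
def of (R : Set (FreeStar X)) (hR : IsBoundedRel R) : FreeStar X →⋆ₐ[ℂ] UnivCStar R hR :=
  CStarCompletion.of (univSeminorm R) (isCStarSeminorm_univSeminorm hR)

theorem denseRange_of : DenseRange (of R hR) := CStarCompletion.denseRange_of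

/-- The canonical generators of the universal C*-algebra. -/
def gen (R : Set (FreeStar X)) (hR : IsBoundedRel R) (x : X) : UnivCStar R hR :=
  of R hR (FreeStar.gen x)

theorem of_eq_eval : of R hR = FreeStar.eval (gen R hR) := by
  refine StarAlgHom.ext fun x => ?_
  induction x using FreeStar.induction with
  | h0 c => rw [AlgHomClass.commutes, AlgHomClass.commutes]
  | h1 y =>
    obtain ⟨x, b⟩ := y
    rw [FreeStar.eval_letter]
    cases b
    · simp [gen, FreeStar.gen]
    · have : FreeStar.letter (x, true) = star (FreeStar.gen x) :=
        (FreeStar.star_letter (x, false)).symm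
      rw [this, map_star]; simp [gen]
  | hm a b ha hb => rw [map_mul, map_mul, ha, hb]
  | ha a b ha hb => rw [map_add, map_add, ha, hb]

/-- The canonical generators satisfy the relations. -/
theorem satisfies_gen : Satisfies R (gen R hR) := fun r hr => by
  rw [← of_eq_eval, ← norm_eq_zero]
  refine (CStarCompletion.norm_of r).trans (le_antisymm (Real.sSup_le ?_ le_rfl)
    ((isCStarSeminorm_univSeminorm hR).nonneg r))
  rintro _ ⟨_, ⟨A, _, a, ha, rfl⟩, rfl⟩
  simp [ha r hr]

variable {B : Type} [CStarAlgebra B]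

/-- The universal property: elements of a C*-algebra which satisfy the relations define a
*-homomorphism. -/
def lift (b : X → B) (hb : Satisfies R b) : UnivCStar R hR →⋆ₐ[ℂ] B :=
  CStarCompletion.lift (FreeStar.eval b) fun x =>
    le_csSup (bddAbove_repSeminorms hR x) ⟨_, ⟨B, inferInstance, b, hb, rfl⟩, rfl⟩

@[simp]
theorem lift_gen (b : X → B) (hb : Satisfies R b) (x : X) :
    lift (hR := hR) b hb (gen R hR x) = b x :=
  (CStarCompletion.lift_of _ _ _).trans (FreeStar.eval_gen b x)

/-- *-homomorphisms out of the universal C*-algebra are determined by the generators. -/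
theorem hom_ext {f g : UnivCStar R hR →⋆ₐ[ℂ] B}
    (h : ∀ x, f (gen R hR x) = g (gen R hR x)) : f = g := by
  have hf : Continuous f := continuous_hom f
  have hg : Continuous g := continuous_hom g
  refine DFunLike.coe_injective (denseRange_of.equalizer hf hg (funext fun x => ?_))
  change f (of R hR x) = g (of R hR x)
  induction x using FreeStar.induction with
  | h0 c => simp only [AlgHomClass.commutes]
  | h1 y =>
    obtain ⟨x, b⟩ := y
    cases b
    · exact h x
    · have : FreeStar.letter (x, true) = star (FreeStar.gen x) :=
        (FreeStar.star_letter (x, false)).symm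
      rw [this, map_star, map_star, map_star]
      exact congrArg star (h x)
  | hm a b ha hb => simp only [map_mul, ha, hb]
  | ha a b ha hb => simp only [map_add, ha, hb]

end UnivCStar

end Universal

section MinTensor

variable {A B : Type} [CStarAlgebra A] [CStarAlgebra B]
variable {H K : Type} [NormedAddCommGroup H] [InnerProductSpace ℂ H] [CompleteSpace H]
  [NormedAddCommGroup K] [InnerProductSpace ℂ K] [CompleteSpace K]

/-- For representations `π` of `A` on `H` and `σ` of `B` on `K`, the representation `π ⊗ σ` of the
algebraic tensor product `A ⊗ B` by bounded operators on the algebraic tensor product `H ⊗ K` with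
its inner product. (The norm of a bounded operator on `H ⊗ K` is the norm of its extension to the
Hilbert space tensor product.) -/
def tensorRep (π : A →⋆ₐ[ℂ] (H →L[ℂ] H)) (σ : B →⋆ₐ[ℂ] (K →L[ℂ] K)) :
    A ⊗[ℂ] B →ₐ[ℂ] (H ⊗[ℂ] K →L[ℂ] H ⊗[ℂ] K) :=
  Algebra.TensorProduct.algHomOfLinearMapTensorProduct
    (TensorProduct.lift (LinearMap.mk₂ ℂ (fun a b => TensorProduct.mapL (π a) (σ b))
      (fun a a' b => by rw [map_add, TensorProduct.mapL_add_left])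
      (fun c a b => by rw [map_smul, TensorProduct.mapL_smul_left])
      (fun a b b' => by rw [map_add, TensorProduct.mapL_add_right])
      (fun c a b => by rw [map_smul, TensorProduct.mapL_smul_right])))
    (fun a a' b b' => by
      simp only [TensorProduct.lift.tmul, LinearMap.mk₂_apply, map_mul, TensorProduct.mapL_mul])
    (by
      simp only [TensorProduct.lift.tmul, LinearMap.mk₂_apply, map_one]
      exact TensorProduct.mapL_id_id)

@[simp]
theorem tensorRep_tmul (π : A →⋆ₐ[ℂ] (H →L[ℂ] H)) (σ : B →⋆ₐ[ℂ] (K →L[ℂ] K)) (a : A) (b : B) :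
    tensorRep π σ (a ⊗ₜ b) = TensorProduct.mapL (π a) (σ b) := rfl

theorem inner_tensorRep (π : A →⋆ₐ[ℂ] (H →L[ℂ] H)) (σ : B →⋆ₐ[ℂ] (K →L[ℂ] K)) (x : A ⊗[ℂ] B)
    (ξ η : H ⊗[ℂ] K) : inner ℂ (tensorRep π σ x ξ) η = inner ℂ ξ (tensorRep π σ (star x) η) := by
  induction x with
  | zero => simp
  | add x y hx hy =>
    simp only [map_add, star_add, add_apply, inner_add_left, inner_add_right,
      hx, hy]
  | tmul a b =>
    induction ξ with
    | zero => simp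
    | add ξ ξ' h h' => simp only [map_add, inner_add_left, h, h']
    | tmul h k =>
      induction η with
      | zero => simp
      | add η η' h h' => simp only [map_add, inner_add_right, h, h']
      | tmul h' k' =>
        rw [TensorProduct.star_tmul, tensorRep_tmul, tensorRep_tmul, TensorProduct.mapL_tmul,
          TensorProduct.mapL_tmul, TensorProduct.inner_tmul, TensorProduct.inner_tmul, map_star,
          map_star, ContinuousLinearMap.star_eq_adjoint, ContinuousLinearMap.star_eq_adjoint,
          ContinuousLinearMap.adjoint_inner_right, ContinuousLinearMap.adjoint_inner_right]

theorem isCStarSeminorm_of_rep {F E : Type} [Ring F] [StarRing F] [Algebra ℂ F]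
    [NormedAddCommGroup E] [InnerProductSpace ℂ E] (T : F →ₐ[ℂ] (E →L[ℂ] E))
    (hT : ∀ x ξ η, inner ℂ (T x ξ) η = inner ℂ ξ (T (star x) η)) :
    IsCStarSeminorm (fun x => ‖T x‖) := by
  have hmul : ∀ x y, ‖T (x * y)‖ ≤ ‖T x‖ * ‖T y‖ :=
    fun x y => by rw [map_mul]; exact norm_mul_le _ _
  have h1 : ∀ x, ‖T x‖ * ‖T x‖ ≤ ‖T (star x * x)‖ := by
    intro x
    have h : ‖T x‖ ≤ √‖T (star x * x)‖ := by
      refine ContinuousLinearMap.opNorm_le_bound _ (Real.sqrt_nonneg _) fun ξ => ?_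
      refine le_of_sq_le_sq ?_ (by positivity)
      rw [mul_pow, Real.sq_sqrt (norm_nonneg _), ← inner_self_eq_norm_sq (𝕜 := ℂ),
        hT, ← mul_apply_eq_comp, ← map_mul]
      calc _ ≤ ‖inner ℂ ξ (T (star x * x) ξ)‖ := RCLike.re_le_norm _
        _ ≤ ‖ξ‖ * ‖T (star x * x) ξ‖ := norm_inner_le_norm _ _
        _ ≤ ‖ξ‖ * (‖T (star x * x)‖ * ‖ξ‖) := by
          gcongr; exact ContinuousLinearMap.le_opNorm _ _
        _ = _ := by ring
    calc _ ≤ √‖T (star x * x)‖ * √‖T (star x * x)‖ :=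
          mul_le_mul h h (norm_nonneg _) (Real.sqrt_nonneg _)
      _ = _ := Real.mul_self_sqrt (norm_nonneg _)
  have h2 : ∀ x, ‖T x‖ ≤ ‖T (star x)‖ := fun x => by
    have h := (h1 x).trans (hmul _ _)
    rcases (norm_nonneg (T x)).eq_or_lt with h0 | h0
    · rw [← h0]; exact norm_nonneg _
    · exact le_of_mul_le_mul_right h h0
  refine ⟨fun _ => norm_nonneg _, fun x y => ?_, fun c x => ?_, hmul, fun x => ?_⟩
  · rw [map_add]; exact norm_add_le _ _
  · rw [map_smul, norm_smul]
  · refine le_antisymm ((hmul _ _).trans ?_) (h1 x)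
    exact mul_le_mul_of_nonneg_right (by simpa using h2 (star x)) (norm_nonneg _)

theorem isCStarSeminorm_tensorRep (π : A →⋆ₐ[ℂ] (H →L[ℂ] H)) (σ : B →⋆ₐ[ℂ] (K →L[ℂ] K)) :
    IsCStarSeminorm (fun x : A ⊗[ℂ] B => ‖tensorRep π σ x‖) :=
  isCStarSeminorm_of_rep (tensorRep π σ) (inner_tensorRep π σ)

/-- The C*-seminorms on the algebraic tensor product `A ⊗ B` given by pairs of (unital)
representations of `A` and `B` on Hilbert spaces. -/
def spatialSeminorms (A B : Type) [CStarAlgebra A] [CStarAlgebra B] : Set (A ⊗[ℂ] B → ℝ) :=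
  {p | ∃ (H : Type) (_ : NormedAddCommGroup H) (_ : InnerProductSpace ℂ H) (_ : CompleteSpace H)
    (K : Type) (_ : NormedAddCommGroup K) (_ : InnerProductSpace ℂ K) (_ : CompleteSpace K)
    (π : A →⋆ₐ[ℂ] (H →L[ℂ] H)) (σ : B →⋆ₐ[ℂ] (K →L[ℂ] K)), p = fun x => ‖tensorRep π σ x‖}

theorem isCStarSeminorm_of_mem_spatialSeminorms :
    ∀ p ∈ spatialSeminorms A B, IsCStarSeminorm p := by
  rintro _ ⟨H, _, _, _, K, _, _, _, π, σ, rfl⟩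
  exact isCStarSeminorm_tensorRep π σ

theorem bddAbove_spatialSeminorms (x : A ⊗[ℂ] B) :
    BddAbove ((fun p : A ⊗[ℂ] B → ℝ => p x) '' spatialSeminorms A B) := by
  suffices h : ∃ C : ℝ, ∀ p ∈ spatialSeminorms A B, p x ≤ C by
    obtain ⟨C, hC⟩ := h
    refine ⟨C, ?_⟩
    rintro _ ⟨p, hp, rfl⟩
    exact hC p hp
  induction x with
  | zero => exact ⟨0, fun p hp => (isCStarSeminorm_of_mem_spatialSeminorms p hp).zero.le⟩
  | add x y hx hy =>
    obtain ⟨C, hC⟩ := hx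
    obtain ⟨D, hD⟩ := hy
    exact ⟨C + D, fun p hp => ((isCStarSeminorm_of_mem_spatialSeminorms p hp).add_le x y).trans
      (add_le_add (hC p hp) (hD p hp))⟩
  | tmul a b =>
    refine ⟨‖a‖ * ‖b‖, ?_⟩
    rintro _ ⟨H, _, _, _, K, _, _, _, π, σ, rfl⟩
    exact (TensorProduct.norm_mapL_le _ _).trans (mul_le_mul
      (NonUnitalStarAlgHom.norm_apply_le π a) (NonUnitalStarAlgHom.norm_apply_le σ b)
      (norm_nonneg _) (norm_nonneg _))

/-- The minimal (spatial) C*-norm on the algebraic tensor product of two C*-algebras. -/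
def minNorm (A B : Type) [CStarAlgebra A] [CStarAlgebra B] (x : A ⊗[ℂ] B) : ℝ :=
  sSup ((fun p : A ⊗[ℂ] B → ℝ => p x) '' spatialSeminorms A B)

theorem isCStarSeminorm_minNorm : IsCStarSeminorm (minNorm A B) :=
  isCStarSeminorm_sSup _ isCStarSeminorm_of_mem_spatialSeminorms bddAbove_spatialSeminorms

/-- The minimal tensor product of two unital C*-algebras. -/
def MinTensor (A B : Type) [CStarAlgebra A] [CStarAlgebra B] : Type :=
  CStarCompletion (minNorm A B) isCStarSeminorm_minNorm

namespace MinTensor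

instance : CStarAlgebra (MinTensor A B) := inferInstanceAs (CStarAlgebra (CStarCompletion _ _))

/-- The canonical map of the algebraic tensor product into the minimal tensor product. -/
def of (A B : Type) [CStarAlgebra A] [CStarAlgebra B] : A ⊗[ℂ] B →⋆ₐ[ℂ] MinTensor A B :=
  CStarCompletion.of (minNorm A B) isCStarSeminorm_minNorm

theorem denseRange_of : DenseRange (of A B) := CStarCompletion.denseRange_of

/-- Elementary tensors. -/
def tmul (a : A) (b : B) : MinTensor A B := of A B (a ⊗ₜ b)

theorem tmul_mul_tmul (a a' : A) (b b' : B) :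
    tmul a b * tmul a' b' = tmul (a * a') (b * b') := by
  rw [tmul, tmul, ← map_mul, Algebra.TensorProduct.tmul_mul_tmul, tmul]

theorem star_tmul (a : A) (b : B) : star (tmul a b) = tmul (star a) (star b) := by
  rw [tmul, ← map_star, TensorProduct.star_tmul, tmul]

theorem one_def : (1 : MinTensor A B) = tmul 1 1 := (map_one (of A B)).symm

variable {A' B' : Type} [CStarAlgebra A'] [CStarAlgebra B']

/-- The tensor product of two *-homomorphisms, on the algebraic tensor product. -/
def algMap (f : A →⋆ₐ[ℂ] A') (g : B →⋆ₐ[ℂ] B') : A ⊗[ℂ] B →⋆ₐ[ℂ] A' ⊗[ℂ] B' where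
  toAlgHom := Algebra.TensorProduct.map (f : A →ₐ[ℂ] A') (g : B →ₐ[ℂ] B')
  map_star' x := by
    change Algebra.TensorProduct.map (f : A →ₐ[ℂ] A') (g : B →ₐ[ℂ] B') (star x) =
      star (Algebra.TensorProduct.map (f : A →ₐ[ℂ] A') (g : B →ₐ[ℂ] B') x)
    induction x with
    | zero => simp
    | add x y hx hy => simp only [map_add, star_add, hx, hy]
    | tmul a b => simp [map_star]

theorem minNorm_algMap_le (f : A →⋆ₐ[ℂ] A') (g : B →⋆ₐ[ℂ] B') (x : A ⊗[ℂ] B) :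
    minNorm A' B' (algMap f g x) ≤ minNorm A B x := by
  refine Real.sSup_le ?_ (isCStarSeminorm_minNorm.nonneg x)
  rintro _ ⟨_, ⟨H, _, _, _, K, _, _, _, π, σ, rfl⟩, rfl⟩
  have h : (tensorRep π σ).comp (algMap f g : A ⊗[ℂ] B →ₐ[ℂ] A' ⊗[ℂ] B') =
      tensorRep (π.comp f) (σ.comp g) := Algebra.TensorProduct.ext' fun a b => rfl
  have h' : tensorRep π σ (algMap f g x) = tensorRep (π.comp f) (σ.comp g) x :=
    DFunLike.congr_fun h x
  change ‖tensorRep π σ (algMap f g x)‖ ≤ _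
  rw [h']
  exact le_csSup (bddAbove_spatialSeminorms x)
    ⟨_, ⟨H, _, _, inferInstance, K, _, _, inferInstance, π.comp f, σ.comp g, rfl⟩, rfl⟩

/-- The tensor product `f ⊗ g` of two *-homomorphisms. -/
def map (f : A →⋆ₐ[ℂ] A') (g : B →⋆ₐ[ℂ] B') : MinTensor A B →⋆ₐ[ℂ] MinTensor A' B' :=
  CStarCompletion.lift ((of A' B').comp (algMap f g)) fun x =>
    (CStarCompletion.norm_of _).trans_le (minNorm_algMap_le f g x)

@[simp]
theorem map_tmul (f : A →⋆ₐ[ℂ] A') (g : B →⋆ₐ[ℂ] B') (a : A) (b : B) :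
    map f g (tmul a b) = tmul (f a) (g b) :=
  CStarCompletion.lift_of _ _ _

/-- The embedding `a ↦ a ⊗ 1`. -/
def inl (A B : Type) [CStarAlgebra A] [CStarAlgebra B] : A →⋆ₐ[ℂ] MinTensor A B where
  toAlgHom := (of A B : A ⊗[ℂ] B →ₐ[ℂ] MinTensor A B).comp Algebra.TensorProduct.includeLeft
  map_star' a := by
    change of A B (star a ⊗ₜ 1) = star (of A B (a ⊗ₜ 1))
    rw [← map_star, TensorProduct.star_tmul, star_one]

/-- The embedding `b ↦ 1 ⊗ b`. -/
def inr (A B : Type) [CStarAlgebra A] [CStarAlgebra B] : B →⋆ₐ[ℂ] MinTensor A B where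
  toAlgHom := (of A B : A ⊗[ℂ] B →ₐ[ℂ] MinTensor A B).comp Algebra.TensorProduct.includeRight
  map_star' b := by
    change of A B (1 ⊗ₜ star b) = star (of A B (1 ⊗ₜ b))
    rw [← map_star, TensorProduct.star_tmul, star_one]

theorem inl_apply (a : A) : inl A B a = tmul a 1 := rfl

theorem inr_apply (b : B) : inr A B b = tmul 1 b := rfl

/-- *-homomorphisms out of the minimal tensor product are determined by elementary tensors. -/
theorem hom_ext {C : Type} [CStarAlgebra C] {f g : MinTensor A B →⋆ₐ[ℂ] C}
    (h : ∀ a b, f (tmul a b) = g (tmul a b)) : f = g := by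
  refine DFunLike.coe_injective (denseRange_of.equalizer (continuous_hom f) (continuous_hom g)
    (funext fun x => ?_))
  change f (of A B x) = g (of A B x)
  induction x with
  | zero => simp
  | add x y hx hy => simp only [map_add, hx, hy]
  | tmul a b => exact h a b

theorem map_map {A'' B'' : Type} [CStarAlgebra A''] [CStarAlgebra B''] (f : A →⋆ₐ[ℂ] A')
    (g : B →⋆ₐ[ℂ] B') (f' : A' →⋆ₐ[ℂ] A'') (g' : B' →⋆ₐ[ℂ] B'') (x : MinTensor A B) :
    map f' g' (map f g x) = map (f'.comp f) (g'.comp g) x := by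
  have h : (map f' g').comp (map f g) = map (f'.comp f) (g'.comp g) :=
    hom_ext fun a b => by simp
  exact DFunLike.congr_fun h x

end MinTensor

end MinTensor

section Torus

/-- Names for the generators of the quantum torus. -/
inductive TorusGen : Type
  | u
  | v

/-- The relations of the quantum two-torus: `u` and `v` are unitary and `u v = μ v u`. -/
def torusRel (μ : ℂ) : Set (FreeStar TorusGen) :=
  let u : FreeStar TorusGen := FreeStar.gen .u
  let v : FreeStar TorusGen := FreeStar.gen .v
  {star u * u - 1, u * star u - 1, star v * v - 1, v * star v - 1, u * v - μ • (v * u)}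

theorem norm_le_one_of_star_mul_self {A : Type} [CStarAlgebra A] {a : A} (h : star a * a = 1) :
    ‖a‖ ≤ 1 := by
  have h1 : ‖(1 : A)‖ ≤ 1 := by simpa using norm_algebraMap_le (A := A) 1
  have h2 := CStarRing.norm_star_mul_self (x := a)
  rw [h] at h2
  nlinarith [norm_nonneg a]

theorem satisfies_torusRel {μ : ℂ} {A : Type} [CStarAlgebra A] (a : TorusGen → A) :
    Satisfies (torusRel μ) a ↔ (star (a .u) * a .u = 1 ∧ a .u * star (a .u) = 1 ∧
      star (a .v) * a .v = 1 ∧ a .v * star (a .v) = 1 ∧ a .u * a .v = μ • (a .v * a .u)) := by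
  simp [Satisfies, torusRel, sub_eq_zero, map_star]

theorem isBoundedRel_torusRel (μ : ℂ) : IsBoundedRel (torusRel μ) := fun x =>
  ⟨1, fun A _ a ha => by
    rw [satisfies_torusRel] at ha
    cases x
    · exact norm_le_one_of_star_mul_self ha.1
    · exact norm_le_one_of_star_mul_self ha.2.2.1⟩

/-- The C*-algebra of continuous functions on the quantum two-torus with parameter `μ`. -/
abbrev QTorus (μ : Circle) : Type := UnivCStar (torusRel (μ : ℂ)) (isBoundedRel_torusRel μ)

theorem zpow_comm_aux {G : Type} [Group G] (u v c : G) (hc : ∀ x, Commute c x) (h : u * v = c * (v * u)) (m n : ℤ) :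
   v ^ m * u ^ n = c ^ (-(m*n)) * (u ^ n * v ^ m) := by
  have h1 : u * v * u⁻¹ = c * v := by rw [h]; group
  have h2 : u * v ^ m * u⁻¹ = c ^ m * v ^ m := by
    rw [← conj_zpow, h1, (hc v).mul_zpow]
  have h3 : (v ^ m)⁻¹ * u * (v ^ m) = c ^ m * u := by
    have : u * v ^ m = v ^ m * (c ^ m * u) := by
      rw [← mul_assoc, ← ((hc (v ^ m)).zpow_left m).eq, ← h2]; group
    rw [mul_assoc, this]; group
  have h4 : (v ^ m)⁻¹ * u ^ n * (v ^ m) = c ^ (m * n) * u ^ n := by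
    have := conj_zpow (a := (v ^ m)⁻¹) (b := u) (i := n)
    rw [inv_inv, h3, ((hc u).zpow_left m).mul_zpow, ← zpow_mul] at this
    exact this.symm
  have h5 : u ^ n * v ^ m = v ^ m * (c ^ (m * n) * u ^ n) := by rw [← h4]; group
  rw [h5, ← mul_assoc (v ^ m), ← ((hc (v ^ m)).zpow_left (m * n)).eq]; group

namespace QTorus

variable (μ : Circle)

/-- The unitary generator `u` of the quantum torus. -/
def u : unitary (QTorus μ) :=
  ⟨UnivCStar.gen _ _ .u, by
    have h := (satisfies_torusRel _).1
      (UnivCStar.satisfies_gen (hR := isBoundedRel_torusRel (μ : ℂ)))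
    exact Unitary.mem_iff.2 ⟨h.1, h.2.1⟩⟩

/-- The unitary generator `v` of the quantum torus. -/
def v : unitary (QTorus μ) :=
  ⟨UnivCStar.gen _ _ .v, by
    have h := (satisfies_torusRel _).1
      (UnivCStar.satisfies_gen (hR := isBoundedRel_torusRel (μ : ℂ)))
    exact Unitary.mem_iff.2 ⟨h.2.2.1, h.2.2.2.1⟩⟩

theorem u_mul_v : (u μ * v μ : QTorus μ) = (μ : ℂ) • (v μ * u μ : QTorus μ) :=
  ((satisfies_torusRel _).1
    (UnivCStar.satisfies_gen (hR := isBoundedRel_torusRel (μ : ℂ)))).2.2.2.2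

/-- The scalar `μ` as a unitary element. -/
def scalar (A : Type) [CStarAlgebra A] (μ : Circle) : unitary A :=
  ⟨algebraMap ℂ A μ, by
    have h : star (μ : ℂ) * (μ : ℂ) = 1 := by
      rw [mul_comm]; exact (Complex.mul_conj _).trans (by simp)
    rw [Unitary.mem_iff, ← algebraMap_star_comm, ← map_mul, ← map_mul, mul_comm (μ : ℂ), h]
    simp⟩

theorem v_zpow_mul_u_zpow (m n : ℤ) :
    ((v μ ^ m : unitary (QTorus μ)) : QTorus μ) * ((u μ ^ n : unitary (QTorus μ)) : QTorus μ) =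
      ((μ ^ (-(m * n)) : Circle) : ℂ) •
        (((u μ ^ n : unitary (QTorus μ)) : QTorus μ) *
          ((v μ ^ m : unitary (QTorus μ)) : QTorus μ)) := by
  have hc : ∀ x : unitary (QTorus μ), Commute (scalar (QTorus μ) μ) x := fun x =>
    Subtype.ext (Algebra.commutes (μ : ℂ) (x : QTorus μ))
  have h := zpow_comm_aux (u μ) (v μ) _ hc (Subtype.ext ((u_mul_v μ).trans
    (Algebra.smul_def (μ : ℂ) (v μ * u μ : QTorus μ)))) m n
  have hs : ∀ k : ℤ, ((scalar (QTorus μ) μ ^ k : unitary (QTorus μ)) : QTorus μ) =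
      algebraMap ℂ (QTorus μ) ((μ ^ k : Circle) : ℂ) := fun k => by
    induction k with
    | zero => simp
    | succ n ih =>
      rw [zpow_add, zpow_one, Submonoid.coe_mul, ih, zpow_add, zpow_one, Circle.coe_mul, map_mul]
      rfl
    | pred n ih =>
      rw [sub_eq_add_neg, zpow_add, zpow_neg_one, Submonoid.coe_mul, ih, zpow_add, zpow_neg_one,
        Circle.coe_mul, map_mul, Circle.coe_inv_eq_conj]
      exact congrArg _ (algebraMap_star_comm (μ : ℂ)).symm
  rw [Algebra.smul_def, ← hs]
  exact congrArg Subtype.val h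

end QTorus

end Torus

section Circle

/-- The function `w ↦ w ^ n` on the circle. -/
def zPow (n : ℤ) : C(Circle, ℂ) := 
  ⟨fun w => ((w ^ n : Circle) : ℂ), continuous_subtype_val.comp (continuous_zpow n)⟩

/-- The canonical generator of the algebra of continuous functions on the circle. -/
def zGen : C(Circle, ℂ) := ⟨fun w => (w : ℂ), by fun_prop⟩

theorem zPow_apply (n : ℤ) (w : Circle) : zPow n w = ((w ^ n : Circle) : ℂ) := rfl

theorem zGen_apply (w : Circle) : zGen w = (w : ℂ) := rfl

theorem zPow_one : zPow 1 = zGen := by ext w; simp [zPow_apply, zGen_apply]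

theorem zPow_zero : zPow 0 = 1 := by ext w; simp [zPow_apply]

theorem zPow_add (m n : ℤ) : zPow (m + n) = zPow m * zPow n := by
  ext w; simp [zPow_apply, zpow_add]

theorem star_zPow (n : ℤ) : star (zPow n) = zPow (-n) := by
  ext w; simp [zPow_apply, ← Circle.coe_inv_eq_conj]

variable {D : Type} [CStarAlgebra D]

/-- The inclusion of the spectrum of a unitary element into the circle. -/
def spectrumToCircle (u : unitary D) : C(spectrum ℂ (u : D), Circle) :=
  ⟨fun x => ⟨x, by
    simpa [Submonoid.unitSphere] using Unitary.spectrum_subset_circle u x.2⟩, by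
    fun_prop⟩

/-- For a unitary `u`, the *-homomorphism `f ↦ f(u)` of the algebra of continuous functions on the
circle which maps the canonical generator to `u`. -/
def circleHom (u : unitary D) : C(Circle, ℂ) →⋆ₐ[ℂ] D :=
  (cfcHom (R := ℂ) (a := (u : D)) (by infer_instance)).comp
    (ContinuousMap.compStarAlgHom' ℂ ℂ (spectrumToCircle u))

theorem circleHom_zGen (u : unitary D) : circleHom u zGen = u :=
  cfcHom_id (R := ℂ) (a := (u : D)) _

theorem circleHom_zPow (u : unitary D) (n : ℤ) :
    circleHom u (zPow n) = ((u ^ n : unitary D) : D) := by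
  induction n with
  | zero => rw [zPow_zero, map_one, zpow_zero, OneMemClass.coe_one]
  | succ n ih =>
    rw [zPow_add, zPow_one, map_mul, ih, circleHom_zGen, zpow_add, zpow_one, Submonoid.coe_mul]
  | pred n ih =>
    rw [sub_eq_add_neg, zPow_add, ← star_zPow 1, zPow_one, map_mul, ih, map_star, circleHom_zGen,
      zpow_add, zpow_neg_one, Submonoid.coe_mul]
    rfl

end Circle

section Braided

/-- An action of the circle group on a unital C*-algebra `A`, as a *-homomorphism
`ρ : A → C(𝕋) ⊗ A`. An element `a` with `ρ a = zⁿ ⊗ a` is called homogeneous of degree `n`. For a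
unital *-homomorphism `ρ`, coassociativity and counitality are equivalent to the density of the
linear span of the homogeneous elements (the spectral subspaces), and this is the form in which
the axioms are imposed here. -/
structure CircleAction (A : Type) [CStarAlgebra A] where
  /-- the coaction -/
  ρ : A →⋆ₐ[ℂ] MinTensor C(Circle, ℂ) A
  dense_span : Dense
    (Submodule.span ℂ {a : A | ∃ n : ℤ, ρ a = MinTensor.tmul (zPow n) a} : Set A)

namespace CircleAction

/-- The trivial action `a ↦ 1 ⊗ a`. -/
def trivial (A : Type) [CStarAlgebra A] : CircleAction A where
  ρ := MinTensor.inr C(Circle, ℂ) A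
  dense_span := by
    have h : {a : A | ∃ n : ℤ, MinTensor.inr C(Circle, ℂ) A a = MinTensor.tmul (zPow n) a} =
        Set.univ := Set.eq_univ_of_forall fun a => ⟨0, by rw [zPow_zero]; rfl⟩
    rw [h, Submodule.span_univ]
    exact dense_univ

variable {A B : Type} [CStarAlgebra A] [CStarAlgebra B]

/-- `a` is homogeneous of degree `n`. -/
def IsHomogeneous (a : CircleAction A) (n : ℤ) (x : A) : Prop :=
  a.ρ x = MinTensor.tmul (zPow n) x

/-- `Φ` is equivariant: `ρ ∘ Φ = (id ⊗ Φ) ∘ ρ`. -/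
def IsEquivariant (a : CircleAction A) (b : CircleAction B) (Φ : A →⋆ₐ[ℂ] B) : Prop :=
  ∀ x, b.ρ (Φ x) = MinTensor.map (StarAlgHom.id ℂ C(Circle, ℂ)) Φ (a.ρ x)

/-- A closed subspace containing all homogeneous elements is everything. -/
theorem mem_of_homogeneous (a : CircleAction A) (S : Submodule ℂ A) (hS : IsClosed (S : Set A))
    (h : ∀ n x, a.IsHomogeneous n x → x ∈ S) (x : A) : x ∈ S := by
  have h1 : Submodule.span ℂ {y : A | ∃ n : ℤ, a.ρ y = MinTensor.tmul (zPow n) y} ≤ S :=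
    Submodule.span_le.2 fun y ⟨n, hy⟩ => h n y hy
  have h2 := closure_minimal (SetLike.coe_subset_coe.2 h1) hS
  exact h2 (a.dense_span x)

end CircleAction

variable (ζ : Circle) {A B : Type} [CStarAlgebra A] [CStarAlgebra B]

/-- The C*-algebra `C(𝕋²_ζ) ⊗ A ⊗ B` in which the braided tensor product lives. -/
abbrev Ambient (A B : Type) [CStarAlgebra A] [CStarAlgebra B] : Type :=
  MinTensor (MinTensor (QTorus ζ) A) B

/-- The *-homomorphism `j₁ : A → C(𝕋²_ζ) ⊗ A ⊗ B`, that is, the action followed by `z ↦ u`. -/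
def j₁ (a : CircleAction A) (B : Type) [CStarAlgebra B] : A →⋆ₐ[ℂ] Ambient ζ A B :=
  (MinTensor.inl (MinTensor (QTorus ζ) A) B).comp
    ((MinTensor.map (circleHom (QTorus.u ζ)) (StarAlgHom.id ℂ A)).comp a.ρ)

/-- The *-homomorphism `j₂ : B → C(𝕋²_ζ) ⊗ A ⊗ B`, that is, the action followed by `z ↦ v`. -/
def j₂ (A : Type) [CStarAlgebra A] (b : CircleAction B) : B →⋆ₐ[ℂ] Ambient ζ A B :=
  (MinTensor.map (MinTensor.inl (QTorus ζ) A) (StarAlgHom.id ℂ B)).comp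
    ((MinTensor.map (circleHom (QTorus.v ζ)) (StarAlgHom.id ℂ B)).comp b.ρ)

variable {ζ}

/-- On homogeneous elements of degree `n` one has `j₁ x = uⁿ ⊗ x ⊗ 1`. -/
theorem j₁_of_homogeneous (a : CircleAction A) {n : ℤ} {x : A} (hx : a.IsHomogeneous n x) :
    j₁ ζ a B x = MinTensor.tmul
      (MinTensor.tmul ((QTorus.u ζ ^ n : unitary (QTorus ζ)) : QTorus ζ) x) 1 := by
  rw [CircleAction.IsHomogeneous] at hx
  simp only [j₁, StarAlgHom.comp_apply, hx, MinTensor.map_tmul, circleHom_zPow,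
    MinTensor.inl_apply, StarAlgHom.coe_id, id_eq]

/-- On homogeneous elements of degree `m` one has `j₂ y = vᵐ ⊗ 1 ⊗ y`. -/
theorem j₂_of_homogeneous (b : CircleAction B) {m : ℤ} {y : B} (hy : b.IsHomogeneous m y) :
    j₂ ζ A b y = MinTensor.tmul
      (MinTensor.tmul ((QTorus.v ζ ^ m : unitary (QTorus ζ)) : QTorus ζ) 1) y := by
  rw [CircleAction.IsHomogeneous] at hy
  simp only [j₂, StarAlgHom.comp_apply, hy, MinTensor.map_tmul, circleHom_zPow,
    MinTensor.inl_apply, StarAlgHom.coe_id, id_eq]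

theorem MinTensor.smul_tmul_left (c : ℂ) (x : A) (y : B) :
    MinTensor.tmul (c • x) y = c • MinTensor.tmul x y := by
  rw [MinTensor.tmul, ← TensorProduct.smul_tmul', map_smul, MinTensor.tmul]

/-- The braiding `j₂(y) j₁(x) = ζ ^ (- deg x deg y) j₁(x) j₂(y)`. -/
theorem braid (a : CircleAction A) (b : CircleAction B) {n m : ℤ} {x : A} {y : B}
    (hx : a.IsHomogeneous n x) (hy : b.IsHomogeneous m y) :
    j₂ ζ A b y * j₁ ζ a B x = ((ζ ^ (-(m * n)) : Circle) : ℂ) • (j₁ ζ a B x * j₂ ζ A b y) := by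
  rw [j₁_of_homogeneous a hx, j₂_of_homogeneous b hy, MinTensor.tmul_mul_tmul,
    MinTensor.tmul_mul_tmul, MinTensor.tmul_mul_tmul, MinTensor.tmul_mul_tmul,
    QTorus.v_zpow_mul_u_zpow, MinTensor.smul_tmul_left, MinTensor.smul_tmul_left]
  simp only [one_mul, mul_one]

/-- The closed linear span of the products `j₁(x) j₂(y)`. -/
def braidedSpan (ζ : Circle) (a : CircleAction A) (b : CircleAction B) :
    Submodule ℂ (Ambient ζ A B) :=
  (Submodule.span ℂ {t | ∃ (x : A) (y : B), t = j₁ ζ a B x * j₂ ζ A b y}).topologicalClosure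

variable (a : CircleAction A) (b : CircleAction B)

theorem isClosed_braidedSpan : IsClosed (braidedSpan ζ a b : Set (Ambient ζ A B)) :=
  Submodule.isClosed_topologicalClosure _

theorem mul_mem_braidedSpan (x : A) (y : B) :
    j₁ ζ a B x * j₂ ζ A b y ∈ braidedSpan ζ a b :=
  Submodule.le_topologicalClosure _ (Submodule.subset_span ⟨x, y, rfl⟩)

theorem braidedSpan_le (S : Submodule ℂ (Ambient ζ A B)) (hS : IsClosed (S : Set (Ambient ζ A B)))
    (h : ∀ x y, j₁ ζ a B x * j₂ ζ A b y ∈ S) : braidedSpan ζ a b ≤ S :=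
  Submodule.topologicalClosure_minimal _
    (Submodule.span_le.2 (by rintro _ ⟨x, y, rfl⟩; exact h x y)) hS

theorem swap_mem_braidedSpan (x : A) (y : B) :
    j₂ ζ A b y * j₁ ζ a B x ∈ braidedSpan ζ a b := by
  have h1 : ∀ (m : ℤ) (y : B), b.IsHomogeneous m y → ∀ x : A,
      j₂ ζ A b y * j₁ ζ a B x ∈ braidedSpan ζ a b := fun m y hy x =>
    a.mem_of_homogeneous ((braidedSpan ζ a b).comap
        ((LinearMap.mulLeft ℂ (j₂ ζ A b y)).comp
          ((j₁ ζ a B : A →ₐ[ℂ] Ambient ζ A B) : A →ₗ[ℂ] Ambient ζ A B)))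
      ((isClosed_braidedSpan a b).preimage
        (continuous_const.mul (continuous_hom (j₁ ζ a B))))
      (fun n x hx => by
        change j₂ ζ A b y * j₁ ζ a B x ∈ braidedSpan ζ a b
        rw [braid a b hx hy]
        exact Submodule.smul_mem _ _ (mul_mem_braidedSpan a b x y)) x
  exact b.mem_of_homogeneous ((braidedSpan ζ a b).comap
      ((LinearMap.mulRight ℂ (j₁ ζ a B x)).comp
        ((j₂ ζ A b : B →ₐ[ℂ] Ambient ζ A B) : B →ₗ[ℂ] Ambient ζ A B)))
    ((isClosed_braidedSpan a b).preimage
      ((continuous_hom (j₂ ζ A b)).mul continuous_const))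
    (fun m y hy => h1 m y hy x) y

theorem mul_left_mem_braidedSpan (x : A) {t : Ambient ζ A B} (ht : t ∈ braidedSpan ζ a b) :
    j₁ ζ a B x * t ∈ braidedSpan ζ a b :=
  braidedSpan_le a b ((braidedSpan ζ a b).comap (LinearMap.mulLeft ℂ (j₁ ζ a B x)))
    ((isClosed_braidedSpan a b).preimage (continuous_const_mul _))
    (fun x' y => by
      change j₁ ζ a B x * (j₁ ζ a B x' * j₂ ζ A b y) ∈ braidedSpan ζ a b
      rw [← mul_assoc, ← map_mul]
      exact mul_mem_braidedSpan a b _ _) ht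

theorem mul_right_mem_braidedSpan (y : B) {t : Ambient ζ A B} (ht : t ∈ braidedSpan ζ a b) :
    t * j₂ ζ A b y ∈ braidedSpan ζ a b :=
  braidedSpan_le a b ((braidedSpan ζ a b).comap (LinearMap.mulRight ℂ (j₂ ζ A b y)))
    ((isClosed_braidedSpan a b).preimage (continuous_mul_const _))
    (fun x y' => by
      change j₁ ζ a B x * j₂ ζ A b y' * j₂ ζ A b y ∈ braidedSpan ζ a b
      rw [mul_assoc, ← map_mul]
      exact mul_mem_braidedSpan a b _ _) ht

theorem braidedSpan_mul_mem {s t : Ambient ζ A B} (hs : s ∈ braidedSpan ζ a b)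
    (ht : t ∈ braidedSpan ζ a b) : s * t ∈ braidedSpan ζ a b := by
  refine braidedSpan_le a b ((braidedSpan ζ a b).comap (LinearMap.mulRight ℂ t))
    ((isClosed_braidedSpan a b).preimage (continuous_mul_const _)) (fun x y => ?_) hs
  refine braidedSpan_le a b ((braidedSpan ζ a b).comap
      (LinearMap.mulLeft ℂ (j₁ ζ a B x * j₂ ζ A b y)))
    ((isClosed_braidedSpan a b).preimage (continuous_const_mul _)) (fun x' y' => ?_) ht
  change j₁ ζ a B x * j₂ ζ A b y * (j₁ ζ a B x' * j₂ ζ A b y') ∈ braidedSpan ζ a b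
  rw [← mul_assoc, mul_assoc (j₁ ζ a B x)]
  exact mul_right_mem_braidedSpan a b y'
    (mul_left_mem_braidedSpan a b x (swap_mem_braidedSpan a b x' y))

theorem braidedSpan_star_mem {s : Ambient ζ A B} (hs : s ∈ braidedSpan ζ a b) :
    star s ∈ braidedSpan ζ a b :=
  braidedSpan_le a b ((braidedSpan ζ a b).comap
      ((starLinearEquiv ℂ : Ambient ζ A B ≃ₗ⋆[ℂ] Ambient ζ A B) :
        Ambient ζ A B →ₗ⋆[ℂ] Ambient ζ A B))
    ((isClosed_braidedSpan a b).preimage continuous_star)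
    (fun x y => by
      change star (j₁ ζ a B x * j₂ ζ A b y) ∈ braidedSpan ζ a b
      rw [star_mul, ← map_star, ← map_star]
      exact swap_mem_braidedSpan a b _ _) hs

/-- The braided tensor product `A ⊠_ζ B`, the closed linear span of `j₁(A) j₂(B)`, as a
*-subalgebra of `C(𝕋²_ζ) ⊗ A ⊗ B`. -/
def braidedSubalgebra (ζ : Circle) (a : CircleAction A) (b : CircleAction B) :
    StarSubalgebra ℂ (Ambient ζ A B) where
  carrier := braidedSpan ζ a b
  mul_mem' := braidedSpan_mul_mem a b
  add_mem' := Submodule.add_mem _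
  algebraMap_mem' c := by
    rw [Algebra.algebraMap_eq_smul_one]
    refine Submodule.smul_mem _ _ ?_
    simpa using mul_mem_braidedSpan (ζ := ζ) a b 1 1
  star_mem' := braidedSpan_star_mem a b

instance : IsClosed (braidedSubalgebra ζ a b : Set (Ambient ζ A B)) := isClosed_braidedSpan a b

/-- The braided tensor product `A ⊠_ζ B` as a C*-algebra. -/
def Braided (ζ : Circle) (a : CircleAction A) (b : CircleAction B) : Type :=
  braidedSubalgebra ζ a b

namespace Braided

instance : CStarAlgebra (Braided ζ a b) :=
  inferInstanceAs (CStarAlgebra (braidedSubalgebra ζ a b))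

/-- The inclusion of the braided tensor product into `C(𝕋²_ζ) ⊗ A ⊗ B`. -/
def incl (ζ : Circle) (a : CircleAction A) (b : CircleAction B) :
    Braided ζ a b →⋆ₐ[ℂ] Ambient ζ A B := (braidedSubalgebra ζ a b).subtype

theorem incl_injective : Function.Injective (incl ζ a b) := Subtype.val_injective

/-- The embedding of the first factor into the braided tensor product. -/
def ι₁ (ζ : Circle) (a : CircleAction A) (b : CircleAction B) : A →⋆ₐ[ℂ] Braided ζ a b :=
  StarAlgHom.codRestrict (j₁ ζ a B) (braidedSubalgebra ζ a b) fun x => by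
    have h := mul_mem_braidedSpan (ζ := ζ) a b x 1
    rwa [map_one, mul_one] at h

/-- The embedding of the second factor into the braided tensor product. -/
def ι₂ (ζ : Circle) (a : CircleAction A) (b : CircleAction B) : B →⋆ₐ[ℂ] Braided ζ a b :=
  StarAlgHom.codRestrict (j₂ ζ A b) (braidedSubalgebra ζ a b) fun y => by
    have h := mul_mem_braidedSpan (ζ := ζ) a b 1 y
    rwa [map_one, one_mul] at h

theorem incl_ι₁ (x : A) : incl ζ a b (ι₁ ζ a b x) = j₁ ζ a B x := rfl

theorem incl_ι₂ (y : B) : incl ζ a b (ι₂ ζ a b y) = j₂ ζ A b y := rfl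

theorem ι₂_mul_ι₁ {n m : ℤ} {x : A} {y : B} (hx : a.IsHomogeneous n x)
    (hy : b.IsHomogeneous m y) :
    ι₂ ζ a b y * ι₁ ζ a b x = ((ζ ^ (-(m * n)) : Circle) : ℂ) • (ι₁ ζ a b x * ι₂ ζ a b y) := by
  refine incl_injective a b ?_
  rw [map_mul, map_smul, map_mul, incl_ι₁, incl_ι₂, braid a b hx hy]

variable {A' B' : Type} [CStarAlgebra A'] [CStarAlgebra B']
variable {a b} {a' : CircleAction A'} {b' : CircleAction B'}
  {Φ : A →⋆ₐ[ℂ] A'} {Ψ : B →⋆ₐ[ℂ] B'}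

/-- The *-homomorphism `id ⊗ Φ ⊗ Ψ`. -/
def ambientMap (ζ : Circle) (Φ : A →⋆ₐ[ℂ] A') (Ψ : B →⋆ₐ[ℂ] B') :
    Ambient ζ A B →⋆ₐ[ℂ] Ambient ζ A' B' :=
  MinTensor.map (MinTensor.map (StarAlgHom.id ℂ (QTorus ζ)) Φ) Ψ

theorem ambientMap_j₁ (hΦ : a.IsEquivariant a' Φ) (x : A) :
    ambientMap ζ Φ Ψ (j₁ ζ a B x) = j₁ ζ a' B' (Φ x) := by
  simp only [ambientMap, j₁, StarAlgHom.comp_apply, hΦ x, MinTensor.map_map, MinTensor.inl_apply,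
    MinTensor.map_tmul, map_one]
  rfl

theorem ambientMap_j₂ (hΨ : b.IsEquivariant b' Ψ) (y : B) :
    ambientMap ζ Φ Ψ (j₂ ζ A b y) = j₂ ζ A' b' (Ψ y) := by
  simp only [ambientMap, j₂, StarAlgHom.comp_apply, hΨ y, MinTensor.map_map]
  refine DFunLike.congr_fun (MinTensor.hom_ext fun f y => ?_) (b.ρ y)
  simp [MinTensor.inl_apply]

/-- The braided tensor product `Φ ⊠_ζ Ψ` of two equivariant *-homomorphisms. -/
def map (ζ : Circle) (hΦ : a.IsEquivariant a' Φ) (hΨ : b.IsEquivariant b' Ψ) :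
    Braided ζ a b →⋆ₐ[ℂ] Braided ζ a' b' :=
  StarAlgHom.codRestrict ((ambientMap ζ Φ Ψ).comp (incl ζ a b)) (braidedSubalgebra ζ a' b')
    fun t => braidedSpan_le a b ((braidedSpan ζ a' b').comap
        ((ambientMap ζ Φ Ψ : Ambient ζ A B →ₐ[ℂ] Ambient ζ A' B') :
          Ambient ζ A B →ₗ[ℂ] Ambient ζ A' B'))
      ((isClosed_braidedSpan a' b').preimage (continuous_hom (ambientMap ζ Φ Ψ)))
      (fun x y => by
        change ambientMap ζ Φ Ψ (j₁ ζ a B x * j₂ ζ A b y) ∈ braidedSpan ζ a' b'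
        rw [map_mul, ambientMap_j₁ hΦ, ambientMap_j₂ hΨ]
        exact mul_mem_braidedSpan a' b' _ _) t.2

/-- `(Φ ⊠ Ψ)(j₁(x) j₂(y)) = j₁(Φ(x)) j₂(Ψ(y))`. -/
theorem map_ι₁_mul_ι₂ (hΦ : a.IsEquivariant a' Φ) (hΨ : b.IsEquivariant b' Ψ) (x : A) (y : B) :
    map ζ hΦ hΨ (ι₁ ζ a b x * ι₂ ζ a b y) = ι₁ ζ a' b' (Φ x) * ι₂ ζ a' b' (Ψ y) := by
  refine incl_injective a' b' ?_
  change ambientMap ζ Φ Ψ (j₁ ζ a B x * j₂ ζ A b y) = j₁ ζ a' B' (Φ x) * j₂ ζ A' b' (Ψ y)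
  rw [map_mul, ambientMap_j₁ hΦ, ambientMap_j₂ hΨ]

end Braided

end Braided

section SU

/-- The relations satisfied by the generators `α`, `γ` of the algebra of functions on the braided
quantum group `SU_q(2)`. -/
structure SURelations {A : Type} [CStarAlgebra A] (q : ℂ) (α γ : A) : Prop where
  star_α_mul_α : star α * α + star γ * γ = 1
  α_mul_star_α : α * star α + ((‖q‖ : ℂ) ^ 2) • (star γ * γ) = 1
  α_mul_γ : α * γ = conj q • (γ * α)
  γ_mul_star_γ : γ * star γ = star γ * γ

namespace SURelations

variable {A : Type} [CStarAlgebra A] {q : ℂ} {α γ : A}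

theorem norm_α_le (h : SURelations q α γ) : ‖α‖ ≤ 1 := by
  let _ := CStarAlgebra.spectralOrder A
  have _ := CStarAlgebra.spectralOrderedRing A
  have h1 : ‖(1 : A)‖ ≤ 1 := by simpa using norm_algebraMap_le (A := A) 1
  have h2 : star α * α ≤ 1 := by
    rw [← h.star_α_mul_α]; exact le_add_of_nonneg_right (star_mul_self_nonneg γ)
  have h3 := CStarAlgebra.norm_le_norm_of_nonneg_of_le (star_mul_self_nonneg α) h2
  rw [CStarRing.norm_star_mul_self] at h3
  nlinarith [norm_nonneg α]

theorem norm_γ_le (h : SURelations q α γ) : ‖γ‖ ≤ 1 := by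
  let _ := CStarAlgebra.spectralOrder A
  have _ := CStarAlgebra.spectralOrderedRing A
  have h1 : ‖(1 : A)‖ ≤ 1 := by simpa using norm_algebraMap_le (A := A) 1
  have h2 : star γ * γ ≤ 1 := by
    rw [← h.star_α_mul_α]; exact le_add_of_nonneg_left (star_mul_self_nonneg α)
  have h3 := CStarAlgebra.norm_le_norm_of_nonneg_of_le (star_mul_self_nonneg γ) h2
  rw [CStarRing.norm_star_mul_self] at h3
  nlinarith [norm_nonneg γ]

theorem norm_sq_eq (q : ℂ) : ((‖q‖ : ℂ) ^ 2) = q * conj q := (Complex.mul_conj' q).symm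

/-- The relation `α γ* = q γ* α`. -/
theorem α_mul_star_γ (h : SURelations q α γ) : α * star γ = q • (star γ * α) := by
  have e1 : star α * α = 1 - star γ * γ := eq_sub_of_add_eq h.star_α_mul_α
  have e2 : (q * conj q) • (star γ * γ) = 1 - α * star α := by
    rw [← norm_sq_eq]; exact eq_sub_of_add_eq' h.α_mul_star_α
  have e3 : star γ * star α = q • (star α * star γ) := by
    have := congrArg star h.α_mul_γ
    simpa only [star_mul, star_smul, RCLike.star_def, Complex.conj_conj] using this
  have e4 := h.γ_mul_star_γ
  rw [← sub_eq_zero, ← CStarRing.star_mul_self_eq_zero_iff]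
  have k1 : γ * star α * (α * star γ) = star γ * γ - star γ * γ * (star γ * γ) := by
    calc γ * star α * (α * star γ) = γ * (star α * α) * star γ := by noncomm_ring
      _ = γ * star γ - γ * star γ * (γ * star γ) := by rw [e1]; noncomm_ring
      _ = _ := by rw [e4]
  have k2 : conj q • (star α * γ * (α * star γ)) = star γ * γ - star γ * γ * (star γ * γ) := by
    calc conj q • (star α * γ * (α * star γ)) = star α * (conj q • (γ * α)) * star γ := by
          simp only [mul_smul_comm, smul_mul_assoc, mul_assoc]
      _ = (star α * α) * (γ * star γ) := by rw [← h.α_mul_γ]; noncomm_ring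
      _ = _ := by rw [e1, e4]; noncomm_ring
  have k3 : q • (γ * star α * (star γ * α)) = star γ * γ - star γ * γ * (star γ * γ) := by
    calc q • (γ * star α * (star γ * α)) = γ * (q • (star α * star γ)) * α := by
          simp only [mul_smul_comm, smul_mul_assoc, mul_assoc]
      _ = γ * star γ * (star α * α) := by rw [← e3]; noncomm_ring
      _ = _ := by rw [e1, e4]; noncomm_ring
  have k4 : (q * conj q) • (star α * γ * (star γ * α)) =
      star γ * γ - star γ * γ * (star γ * γ) := by
    calc (q * conj q) • (star α * γ * (star γ * α))
        = star α * ((q * conj q) • (γ * star γ)) * α := by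
          simp only [mul_smul_comm, smul_mul_assoc, mul_assoc]
      _ = star α * α - star α * α * (star α * α) := by rw [e4, e2]; noncomm_ring
      _ = _ := by rw [e1]; noncomm_ring
  have k : star (α * star γ - q • (star γ * α)) * (α * star γ - q • (star γ * α)) =
      γ * star α * (α * star γ) - conj q • (star α * γ * (α * star γ)) -
        q • (γ * star α * (star γ * α)) + (q * conj q) • (star α * γ * (star γ * α)) := by
    simp only [star_sub, star_mul, star_star, star_smul, RCLike.star_def, mul_sub, sub_mul,
      smul_mul_assoc, mul_smul_comm]
    module
  rw [k, k1, k2, k3, k4]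
  abel

set_option linter.unusedSimpArgs false in
/-- The elements that define the comultiplication satisfy the relations. -/
theorem comul {q : ℂ} (hq : q ≠ 0) {a₁ c₁ a₂ c₂ : A} (h₁ : SURelations q a₁ c₁)
    (h₂ : SURelations q a₂ c₂)
    (haa : a₂ * a₁ = a₁ * a₂) (haa' : a₂ * star a₁ = star a₁ * a₂)
    (hac : a₂ * c₁ = c₁ * a₂) (hac' : a₂ * star c₁ = star c₁ * a₂)
    (hca : c₂ * a₁ = a₁ * c₂) (hca' : c₂ * star a₁ = star a₁ * c₂)
    (hcc : c₂ * c₁ = (conj q / q) • (c₁ * c₂))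
    (hcc' : c₂ * star c₁ = (q / conj q) • (star c₁ * c₂)) :
    SURelations q (a₁ * a₂ - q • (star c₁ * c₂)) (c₁ * a₂ + star a₁ * c₂) := by
  have hq' : conj q ≠ 0 := by simpa using hq
  have leg : ∀ {a c : A}, SURelations q a c →
      (star a * a = 1 - star c * c) ∧ (a * star a = 1 - (q * conj q) • (star c * c)) ∧
      a * c = conj q • (c * a) ∧ c * star c = star c * c ∧ a * star c = q • (star c * a) ∧
      star a * star c = q⁻¹ • (star c * star a) ∧ star a * c = (conj q)⁻¹ • (c * star a) := by
    intro a c h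
    refine ⟨eq_sub_of_add_eq h.star_α_mul_α, ?_, h.α_mul_γ, h.γ_mul_star_γ, h.α_mul_star_γ, ?_, ?_⟩
    · rw [← norm_sq_eq]; exact eq_sub_of_add_eq h.α_mul_star_α
    · have := congrArg star h.α_mul_γ
      simp only [star_mul, star_smul, RCLike.star_def, Complex.conj_conj] at this
      rw [this, smul_smul, inv_mul_cancel₀ hq, one_smul]
    · have := congrArg star h.α_mul_star_γ
      simp only [star_mul, star_star, star_smul, RCLike.star_def] at this
      rw [this, smul_smul, inv_mul_cancel₀ hq', one_smul]
  obtain ⟨p1, p2, p3, p4, p5, p6, p7⟩ := leg h₁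
  obtain ⟨s1, s2, s3, s4, s5, s6, s7⟩ := leg h₂
  have t1 : star a₂ * star a₁ = star a₁ * star a₂ := by
    simpa only [star_mul] using (congrArg star haa).symm
  have t2 : star a₂ * a₁ = a₁ * star a₂ := by
    simpa only [star_mul, star_star] using (congrArg star haa').symm
  have t3 : star a₂ * star c₁ = star c₁ * star a₂ := by
    simpa only [star_mul] using (congrArg star hac).symm
  have t4 : star a₂ * c₁ = c₁ * star a₂ := by
    simpa only [star_mul, star_star] using (congrArg star hac').symm
  have t5 : star c₂ * star a₁ = star a₁ * star c₂ := by
    simpa only [star_mul] using (congrArg star hca).symm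
  have t6 : star c₂ * a₁ = a₁ * star c₂ := by
    simpa only [star_mul, star_star] using (congrArg star hca').symm
  have t7 : star c₂ * star c₁ = (conj q / q) • (star c₁ * star c₂) := by
    have := congrArg star hcc
    simp only [star_mul, star_smul, RCLike.star_def, map_div₀, Complex.conj_conj] at this
    rw [this, smul_smul, div_mul_div_cancel₀ hq, div_self hq', one_smul]
  have t8 : star c₂ * c₁ = (q / conj q) • (c₁ * star c₂) := by
    have := congrArg star hcc'
    simp only [star_mul, star_star, star_smul, RCLike.star_def, map_div₀,
      Complex.conj_conj] at this
    rw [this, smul_smul, div_mul_div_cancel₀ hq', div_self hq, one_smul]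
  have r : ∀ {x y z : A}, x * y = z → ∀ t, x * (y * t) = z * t := fun h t => by
    rw [← mul_assoc, h]
  refine ⟨?_, ?_, ?_, ?_⟩ <;> (try rw [norm_sq_eq]) <;>
    simp only [star_sub, star_add, star_mul, star_star, star_smul, RCLike.star_def, mul_add,
      add_mul, mul_sub, sub_mul, smul_mul_assoc, mul_smul_comm, mul_assoc, smul_add, smul_sub,
      smul_smul, one_mul, mul_one,
      p1, p2, p3, p4, p5, p6, p7, s1, s2, s3, s4, s5, s6, s7, t1, t2, t3, t4, t5, t6, t7, t8,
      haa, haa', hac, hac', hca, hca', hcc, hcc',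
      r p1, r p2, r p3, r p4, r p5, r p6, r p7, r s1, r s2, r s3, r s4, r s5, r s6, r s7,
      r t1, r t2, r t3, r t4, r t5, r t6, r t7, r t8,
      r haa, r haa', r hac, r hac', r hca, r hca', r hcc, r hcc'] <;>
    match_scalars <;> field_simp <;> ring

end SURelations

/-- Names for the generators of the algebra of functions on `SU_q(2)`. -/
inductive SUGen : Type
  | α
  | γ

/-- The defining relations of the algebra of functions on `SU_q(2)`, as *-polynomials. -/
def suRel (q : ℂ) : Set (FreeStar SUGen) :=
  let α : FreeStar SUGen := FreeStar.gen .α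
  let γ : FreeStar SUGen := FreeStar.gen .γ
  {star α * α + star γ * γ - 1, α * star α + ((‖q‖ : ℂ) ^ 2) • (star γ * γ) - 1,
    α * γ - conj q • (γ * α), γ * star γ - star γ * γ}

theorem satisfies_suRel {q : ℂ} {A : Type} [CStarAlgebra A] (a : SUGen → A) :
    Satisfies (suRel q) a ↔ SURelations q (a .α) (a .γ) := by
  simp only [Satisfies, suRel, Set.mem_insert_iff, Set.mem_singleton_iff, forall_eq_or_imp,
    forall_eq, map_sub, map_add, map_mul, map_smul, map_star, map_one, FreeStar.eval_gen,
    sub_eq_zero]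
  exact ⟨fun h => ⟨h.1, h.2.1, h.2.2.1, h.2.2.2⟩, fun h => ⟨h.1, h.2, h.3, h.4⟩⟩

theorem isBoundedRel_suRel (q : ℂ) : IsBoundedRel (suRel q) := fun x =>
  ⟨1, fun A _ a ha => by
    rw [satisfies_suRel] at ha
    cases x
    · exact ha.norm_α_le
    · exact ha.norm_γ_le⟩

/-- `C(SU_q(2))`: the universal C*-algebra generated by two elements `α` and `γ` subject to the
relations `α* α + γ* γ = 1`, `α α* + |q|² γ* γ = 1`, `α γ = q̄ γ α`, `γ γ* = γ* γ`. -/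
abbrev CSU (q : ℂ) : Type := UnivCStar (suRel q) (isBoundedRel_suRel q)

namespace CSU

/-- The generator `α`. -/
def α (q : ℂ) : CSU q := UnivCStar.gen _ _ .α

/-- The generator `γ`. -/
def γ (q : ℂ) : CSU q := UnivCStar.gen _ _ .γ

theorem relations (q : ℂ) : SURelations q (α q) (γ q) :=
  (satisfies_suRel _).1 UnivCStar.satisfies_gen

variable {q : ℂ}

/-- The *-homomorphism out of `C(SU_q(2))` with given values on the generators. -/
def lift {B : Type} [CStarAlgebra B] (a c : B) (h : SURelations q a c) : CSU q →⋆ₐ[ℂ] B :=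
  UnivCStar.lift (fun x => match x with
    | .α => a
    | .γ => c) ((satisfies_suRel _).2 h)

@[simp]
theorem lift_α {B : Type} [CStarAlgebra B] (a c : B) (h : SURelations q a c) :
    lift a c h (α q) = a := UnivCStar.lift_gen _ _ _

@[simp]
theorem lift_γ {B : Type} [CStarAlgebra B] (a c : B) (h : SURelations q a c) :
    lift a c h (γ q) = c := UnivCStar.lift_gen _ _ _

theorem hom_ext {B : Type} [CStarAlgebra B] {f g : CSU q →⋆ₐ[ℂ] B} (hα : f (α q) = g (α q))
    (hγ : f (γ q) = g (γ q)) : f = g :=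
  UnivCStar.hom_ext fun x => by
    cases x
    · exact hα
    · exact hγ

theorem action_relations (q : ℂ) : SURelations q
    (MinTensor.tmul (1 : C(Circle, ℂ)) (α q)) (MinTensor.tmul zGen (γ q)) := by
  have h := relations q
  have hz : star zGen * zGen = 1 := by
    rw [← zPow_one, star_zPow, ← zPow_add, neg_add_cancel, zPow_zero]
  have add_r : ∀ (f : C(Circle, ℂ)) (x y : CSU q),
      MinTensor.tmul f x + MinTensor.tmul f y = MinTensor.tmul f (x + y) := fun f x y => by
    rw [MinTensor.tmul, MinTensor.tmul, ← map_add, ← TensorProduct.tmul_add, MinTensor.tmul]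
  have smul_r : ∀ (c : ℂ) (f : C(Circle, ℂ)) (x : CSU q),
      c • MinTensor.tmul f x = MinTensor.tmul f (c • x) := fun c f x => by
    rw [MinTensor.tmul, ← map_smul, ← TensorProduct.tmul_smul, MinTensor.tmul]
  refine ⟨?_, ?_, ?_, ?_⟩
  · rw [MinTensor.star_tmul, MinTensor.star_tmul, MinTensor.tmul_mul_tmul,
      MinTensor.tmul_mul_tmul, hz, star_one, one_mul, add_r, h.star_α_mul_α, MinTensor.one_def]
  · rw [MinTensor.star_tmul, MinTensor.star_tmul, MinTensor.tmul_mul_tmul,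
      MinTensor.tmul_mul_tmul, hz, star_one, one_mul, smul_r, add_r, h.α_mul_star_α,
      MinTensor.one_def]
  · rw [MinTensor.tmul_mul_tmul, MinTensor.tmul_mul_tmul, smul_r, h.α_mul_γ, mul_comm zGen]
  · rw [MinTensor.star_tmul, MinTensor.tmul_mul_tmul, MinTensor.tmul_mul_tmul, h.γ_mul_star_γ,
      mul_comm zGen]

/-- The coaction `α ↦ 1 ⊗ α`, `γ ↦ z ⊗ γ` of the circle. -/
def coaction (q : ℂ) : CSU q →⋆ₐ[ℂ] MinTensor C(Circle, ℂ) (CSU q) :=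
  lift _ _ (action_relations q)

theorem coaction_mul {m n : ℤ} {x y : CSU q} (hx : coaction q x = MinTensor.tmul (zPow m) x)
    (hy : coaction q y = MinTensor.tmul (zPow n) y) :
    coaction q (x * y) = MinTensor.tmul (zPow (m + n)) (x * y) := by
  rw [map_mul, hx, hy, MinTensor.tmul_mul_tmul, zPow_add]

theorem coaction_star {m : ℤ} {x : CSU q} (hx : coaction q x = MinTensor.tmul (zPow m) x) :
    coaction q (star x) = MinTensor.tmul (zPow (-m)) (star x) := by
  rw [map_star, hx, MinTensor.star_tmul, star_zPow]

theorem coaction_α : coaction q (α q) = MinTensor.tmul (zPow 0) (α q) := by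
  rw [coaction, lift_α, zPow_zero]

theorem coaction_γ : coaction q (γ q) = MinTensor.tmul (zPow 1) (γ q) := by
  rw [coaction, lift_γ, zPow_one]

/-- The action of the circle on `C(SU_q(2))` determined by `α ↦ 1 ⊗ α`, `γ ↦ z ⊗ γ`. -/
def action (q : ℂ) : CircleAction (CSU q) where
  ρ := coaction q
  dense_span := by
    let S : Submodule ℂ (CSU q) :=
      Submodule.span ℂ {x | ∃ n : ℤ, coaction q x = MinTensor.tmul (zPow n) x}
    have hS : ∀ {x : CSU q} (n : ℤ), coaction q x = MinTensor.tmul (zPow n) x → x ∈ S :=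
      fun n hx => Submodule.subset_span ⟨n, hx⟩
    have h1 : (1 : CSU q) ∈ S := hS 0 (by rw [map_one, zPow_zero, MinTensor.one_def])
    have hmul : ∀ x ∈ S, ∀ y ∈ S, x * y ∈ S := by
      intro x hx y hy
      induction hx using Submodule.span_induction with
      | mem x hx =>
        obtain ⟨m, hx⟩ := hx
        induction hy using Submodule.span_induction with
        | mem y hy =>
          obtain ⟨n, hy⟩ := hy
          exact hS _ (coaction_mul hx hy)
        | zero => rw [mul_zero]; exact S.zero_mem
        | add y y' _ _ h h' => rw [mul_add]; exact S.add_mem h h'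
        | smul c y _ h => rw [mul_smul_comm]; exact S.smul_mem c h
      | zero => rw [zero_mul]; exact S.zero_mem
      | add x x' _ _ h h' => rw [add_mul]; exact S.add_mem h h'
      | smul c x _ h => rw [smul_mul_assoc]; exact S.smul_mem c h
    refine UnivCStar.denseRange_of.mono ?_
    rintro _ ⟨x, rfl⟩
    change UnivCStar.of (suRel q) (isBoundedRel_suRel q) x ∈ S
    induction x using FreeStar.induction with
    | h0 c =>
      rw [AlgHomClass.commutes, Algebra.algebraMap_eq_smul_one]
      exact S.smul_mem c h1
    | h1 y =>
      rw [UnivCStar.of_eq_eval, FreeStar.eval_letter]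
      obtain ⟨g, b⟩ := y
      cases g <;> cases b
      · exact hS 0 coaction_α
      · exact hS _ (coaction_star coaction_α)
      · exact hS 1 coaction_γ
      · exact hS _ (coaction_star coaction_γ)
    | hm a b ha hb => rw [map_mul]; exact hmul _ ha _ hb
    | ha a b ha hb => rw [map_add]; exact S.add_mem ha hb

theorem action_ρ : (action q).ρ = coaction q := rfl

theorem homogeneous_α : (action q).IsHomogeneous 0 (α q) := coaction_α

theorem homogeneous_γ : (action q).IsHomogeneous 1 (γ q) := coaction_γ

theorem homogeneous_star_α : (action q).IsHomogeneous 0 (star (α q)) := by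
  have h := coaction_star (coaction_α (q := q))
  rw [neg_zero] at h
  exact h

theorem homogeneous_star_γ : (action q).IsHomogeneous (-1) (star (γ q)) :=
  coaction_star coaction_γ

end CSU

/-- The parameter `ζ = q / q̄` of the braiding. -/
def zeta (q : ℂ) (hq : q ≠ 0) : Circle :=
  ⟨q / conj q, by
    simp [Submonoid.unitSphere, div_self (norm_ne_zero_iff.2 hq)]⟩

theorem SURelations.map {A B : Type} [CStarAlgebra A] [CStarAlgebra B] {q : ℂ} {α γ : A}
    (h : SURelations q α γ) (f : A →⋆ₐ[ℂ] B) : SURelations q (f α) (f γ) where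
  star_α_mul_α := by rw [← map_star, ← map_star, ← map_mul, ← map_mul, ← map_add,
    h.star_α_mul_α, map_one]
  α_mul_star_α := by rw [← map_star, ← map_star, ← map_mul, ← map_mul, ← map_smul, ← map_add,
    h.α_mul_star_α, map_one]
  α_mul_γ := by rw [← map_mul, ← map_mul, ← map_smul, h.α_mul_γ]
  γ_mul_star_γ := by rw [← map_star, ← map_mul, ← map_mul, h.γ_mul_star_γ]

open CSU

/-- `C(SU_q(2)) ⊠_ζ C(SU_q(2))`. -/
abbrev CSU₂ (q : ℂ) (hq : q ≠ 0) : Type := Braided (zeta q hq) (action q) (action q)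

/-- The first embedding of `C(SU_q(2))` into `C(SU_q(2)) ⊠_ζ C(SU_q(2))`. -/
abbrev in₁ (q : ℂ) (hq : q ≠ 0) : CSU q →⋆ₐ[ℂ] CSU₂ q hq :=
  Braided.ι₁ (zeta q hq) (action q) (action q)

/-- The second embedding of `C(SU_q(2))` into `C(SU_q(2)) ⊠_ζ C(SU_q(2))`. -/
abbrev in₂ (q : ℂ) (hq : q ≠ 0) : CSU q →⋆ₐ[ℂ] CSU₂ q hq :=
  Braided.ι₂ (zeta q hq) (action q) (action q)

section Comul

variable (q : ℂ) (hq : q ≠ 0)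

theorem comul_relations : SURelations q
    (in₁ q hq (α q) * in₂ q hq (α q) - q • (in₁ q hq (star (γ q)) * in₂ q hq (γ q)))
    (in₁ q hq (γ q) * in₂ q hq (α q) + in₁ q hq (star (α q)) * in₂ q hq (γ q)) := by
  have hb : ∀ {n m : ℤ} {x y : CSU q}, (action q).IsHomogeneous n x →
      (action q).IsHomogeneous m y → in₂ q hq y * in₁ q hq x =
        (((zeta q hq) ^ (-(m * n)) : Circle) : ℂ) • (in₁ q hq x * in₂ q hq y) := fun hx hy =>
    Braided.ι₂_mul_ι₁ (action q) (action q) hx hy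
  have hz : ((zeta q hq : Circle) : ℂ) = q / conj q := rfl
  have h := SURelations.comul hq ((relations q).map (in₁ q hq)) ((relations q).map (in₂ q hq))
    (by simpa using hb homogeneous_α homogeneous_α)
    (by simpa [map_star] using hb homogeneous_star_α homogeneous_α)
    (by simpa using hb homogeneous_γ homogeneous_α)
    (by simpa [map_star] using hb homogeneous_star_γ homogeneous_α)
    (by simpa using hb homogeneous_α homogeneous_γ)
    (by simpa [map_star] using hb homogeneous_star_α homogeneous_γ)
    (by simpa [hz] using hb homogeneous_γ homogeneous_γ)
    (by simpa [hz, map_star] using hb homogeneous_star_γ homogeneous_γ)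
  simpa only [map_star] using h

/-- The comultiplication of the braided quantum group `SU_q(2)`, determined by
`Δ(α) = j₁(α) j₂(α) - q j₁(γ*) j₂(γ)` and `Δ(γ) = j₁(γ) j₂(α) + j₁(α*) j₂(γ)`. -/
def comul : CSU q →⋆ₐ[ℂ] CSU₂ q hq :=
  CSU.lift _ _ (comul_relations q hq)

theorem comul_α : comul q hq (α q) =
    in₁ q hq (α q) * in₂ q hq (α q) - q • (in₁ q hq (star (γ q)) * in₂ q hq (γ q)) :=
  CSU.lift_α _ _ _

theorem comul_γ : comul q hq (γ q) =
    in₁ q hq (γ q) * in₂ q hq (α q) + in₁ q hq (star (α q)) * in₂ q hq (γ q) :=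
  CSU.lift_γ _ _ _

end Comul

section Quotient

theorem pi_relations (q : ℂ) : SURelations q zGen (0 : C(Circle, ℂ)) := by
  have hz : star zGen * zGen = 1 := by
    rw [← zPow_one, star_zPow, ← zPow_add, neg_add_cancel, zPow_zero]
  exact ⟨by simpa using hz, by simpa [mul_comm] using hz, by simp, by simp⟩

/-- The *-homomorphism `π : C(SU_q(2)) → C(𝕋)` with `π(α) = z` and `π(γ) = 0`. -/
def piHom (q : ℂ) : CSU q →⋆ₐ[ℂ] C(Circle, ℂ) := CSU.lift zGen 0 (pi_relations q)

theorem MinTensor.tmul_zero {A B : Type} [CStarAlgebra A] [CStarAlgebra B] (x : A) :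
    MinTensor.tmul x (0 : B) = 0 := by
  rw [MinTensor.tmul, TensorProduct.tmul_zero, map_zero]

/-- `π` is equivariant for the trivial action of the circle on `C(𝕋)`. -/
theorem isEquivariant_piHom (q : ℂ) :
    (action q).IsEquivariant (CircleAction.trivial C(Circle, ℂ)) (piHom q) := by
  have h : (MinTensor.inr C(Circle, ℂ) C(Circle, ℂ)).comp (piHom q) =
      (MinTensor.map (StarAlgHom.id ℂ C(Circle, ℂ)) (piHom q)).comp (coaction q) := by
    refine CSU.hom_ext ?_ ?_
    · rw [StarAlgHom.comp_apply, StarAlgHom.comp_apply, coaction_α, MinTensor.map_tmul, zPow_zero]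
      rfl
    · rw [StarAlgHom.comp_apply, StarAlgHom.comp_apply, coaction_γ, MinTensor.map_tmul, piHom,
        CSU.lift_γ, map_zero, MinTensor.tmul_zero]
  exact fun x => DFunLike.congr_fun h x

theorem isEquivariant_id {A : Type} [CStarAlgebra A] (a : CircleAction A) :
    a.IsEquivariant a (StarAlgHom.id ℂ A) := fun x => by
  have h : MinTensor.map (StarAlgHom.id ℂ C(Circle, ℂ)) (StarAlgHom.id ℂ A) =
      StarAlgHom.id ℂ (MinTensor C(Circle, ℂ) A) := MinTensor.hom_ext fun f y => by simp
  rw [h]; rfl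

/-- The map `(id ⊠_ζ π) ∘ Δ : C(SU_q(2)) → C(SU_q(2)) ⊠_ζ C(𝕋)`, where the circle acts trivially
on `C(𝕋)`. -/
def rightAction (q : ℂ) (hq : q ≠ 0) :
    CSU q →⋆ₐ[ℂ] Braided (zeta q hq) (action q) (CircleAction.trivial C(Circle, ℂ)) :=
  (Braided.map (zeta q hq) (isEquivariant_id (action q)) (isEquivariant_piHom q)).comp
    (comul q hq)

/-- The algebra `C(S²_q)` of functions on the quotient sphere `SU_q(2)/𝕋`: the set of all `a` with
`((id ⊠_ζ π) ∘ Δ)(a) = a ⊗ 1`. Since the circle acts trivially on `C(𝕋)`, the braided tensor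
product `C(SU_q(2)) ⊠_ζ C(𝕋)` is the ordinary one, `j₁(a)` corresponding to `a ⊗ 1`. -/
def quotientSphere (q : ℂ) (hq : q ≠ 0) : StarSubalgebra ℂ (CSU q) :=
  StarAlgHom.equalizer (rightAction q hq)
    (Braided.ι₁ (zeta q hq) (action q) (CircleAction.trivial C(Circle, ℂ)))

/-- The relations of the standard Podleś sphere with the real parameter `p`. -/
structure PodlesRelations {E : Type} [CStarAlgebra E] (p : ℝ) (A B : E) : Prop where
  star_B_mul_B : star B * B = A - A ^ 2
  B_mul_star_B : B * star B = (p ^ 2) • A - (p ^ 4) • A ^ 2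
  B_mul_A : B * A = (p ^ 2) • (A * B)
  star_A : star A = A

end Quotient

end SU

end BraidedSU2

end

open scoped TensorProduct ComplexConjugate

noncomputable section

/-! Since `π(γ) = 0`, the map `(id ⊠ π)Δ` sends `α` to `j₁(α) j₂(z)` and `γ` to `j₁(γ) j₂(z)`, and
`j₂(z) = 1 ⊗ 1 ⊗ z` is a central unitary because the circle acts trivially on `C(𝕋)`. So the
quotient sphere should be the fixed point algebra of the circle of automorphisms `α ↦ wα`, `γ ↦ wγ`
(`gauge`), that is, the part of total degree zero when `α`, `γ` have degree 1 and their adjoints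
degree -1. This grading differs from the one that defines the braiding, where `α` has degree 0.

From invariance under `(id ⊠ π)Δ` to invariance under `gauge` (`gauge_eq_of_mem_quotientSphere`):
the unitary `u` in the torus leg has to be removed. The quantum torus acts on square summable
functions on the integers, and `u` fixes the vector at 0. On vectors `vacuum ⊗ k ⊗ 1`, with `z`
evaluated at `w`, the two sides of the defining equation act as `gauge q w a` and as `a` in an
arbitrary representation. Representations separate points by the GNS construction, so `gauge q w a =
a`.

From invariance to the closure (`mem_closure_of_invariant`): let `S` be the *-algebra generated by
`αγ*` and `γ*γ`, `P` the span of `α, γ` and `Q` the span of their adjoints. The relations give `PQ,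
QP ≤ S`, `PS ≤ SP` and `QS ≤ SQ`, so the sum of all `S Pⁿ` and `S Qⁿ` is stable under right
multiplication by the generators and is dense (`dense_polySpan`). Averaging over the `N`-th roots of
unity is contractive, fixes invariant elements, and kills `S Pⁿ` and `S Qⁿ` for `0 < n < N`.
Averaging a polynomial close to an invariant `a` therefore gives an element of `S` equally close to
`a`.

The reverse inclusion is a check on the two generators, as the quotient sphere is a closed
*-subalgebra. The Podleś relations are algebra, based on `αγ* = qγ*α`. -/

namespace BraidedSU2


/-! ### The Podleś relations. -/

namespace SURelations

variable {A : Type} [CStarAlgebra A] {q : ℂ} {α γ : A}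

theorem γ_mul_star_α (h : SURelations q α γ) : γ * star α = conj q • (star α * γ) := by
  have := congrArg star h.α_mul_star_γ
  simpa only [star_mul, star_star, star_smul, RCLike.star_def] using this

/-- Moving `α` past `γ*` costs `q` and past `γ` costs `conj q`. The product is written as a real
scalar, the form required by `PodlesRelations`. -/
theorem α_mul_star_γ_mul_γ (h : SURelations q α γ) :
    α * (star γ * γ) = (‖q‖ ^ 2) • (star γ * γ * α) := by
  have e : ((‖q‖ ^ 2 : ℝ) : ℂ) = q * conj q := by push_cast; exact norm_sq_eq q
  rw [← mul_assoc, h.α_mul_star_γ, smul_mul_assoc, mul_assoc, h.α_mul_γ, mul_smul_comm,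
    smul_smul, ← e, mul_assoc, Complex.coe_smul]

/-- The elements `γ* γ` and `α γ*` satisfy the relations of the standard Podleś sphere. -/
theorem podlesRelations (h : SURelations q α γ) :
    PodlesRelations ‖q‖ (star γ * γ) (α * star γ) where
  star_B_mul_B := by
    have e1 : star α * α = 1 - star γ * γ := eq_sub_of_add_eq h.star_α_mul_α
    calc star (α * star γ) * (α * star γ) = γ * (star α * α) * star γ := by
          rw [star_mul, star_star]; noncomm_ring
      _ = γ * star γ - γ * star γ * (γ * star γ) := by rw [e1]; noncomm_ring
      _ = _ := by rw [h.γ_mul_star_γ, sq]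
  B_mul_star_B := by
    have e2 : α * star α = 1 - (‖q‖ ^ 2) • (star γ * γ) := by
      rw [← Complex.coe_smul]
      push_cast
      exact eq_sub_of_add_eq h.α_mul_star_α
    calc α * star γ * star (α * star γ) = α * (star γ * γ) * star α := by
          rw [star_mul, star_star]; noncomm_ring
      _ = (‖q‖ ^ 2) • (star γ * γ * (α * star α)) := by
          rw [h.α_mul_star_γ_mul_γ, smul_mul_assoc, mul_assoc (star γ * γ)]
      _ = _ := by
          rw [e2, mul_sub, mul_one, mul_smul_comm, smul_sub, smul_smul, sq (star γ * γ)]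
          ring_nf
  B_mul_A := by
    -- Normality of `γ` carries one `γ*` to the right end, so that `α` meets `γ*γ`.
    calc α * star γ * (star γ * γ) = α * (star γ * γ) * star γ := by
          rw [mul_assoc, mul_assoc, mul_assoc (star γ) γ, h.γ_mul_star_γ]
      _ = _ := by rw [h.α_mul_star_γ_mul_γ, smul_mul_assoc, mul_assoc (star γ * γ)]
  star_A := by rw [star_mul, star_star]

end SURelations

/-! ### Products of subspaces and the grading by total degree. -/

section Sphere

variable {A : Type} [CStarAlgebra A] {q : ℂ} {α γ : A}

/-- The *-algebra generated by `α γ*` and `γ* γ`. -/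
def sphereAlgebra (α γ : A) : StarSubalgebra ℂ A :=
  StarAlgebra.adjoin ℂ {α * star γ, star γ * γ}

/-- The *-algebra generated by `α γ*` and `γ* γ`, as a linear subspace. -/
def sphereSpan (α γ : A) : Submodule ℂ A := Subalgebra.toSubmodule (sphereAlgebra α γ).toSubalgebra

/-- The span of `α` and `γ`. -/
def genSpan (α γ : A) : Submodule ℂ A := Submodule.span ℂ {α, γ}

/-- Closure properties are phrased as inequalities between products of subspaces; the degree
arguments below then become computations in an ordered semiring. -/
theorem sphereSpan_mul_self : sphereSpan α γ * sphereSpan α γ ≤ sphereSpan α γ :=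
  Submodule.mul_le.2 fun _ hx _ hy => mul_mem (S := StarSubalgebra ℂ A) hx hy

theorem one_mem_sphereSpan : (1 : A) ∈ sphereSpan α γ := one_mem (sphereAlgebra α γ)

theorem α_mul_star_γ_mem : α * star γ ∈ sphereSpan α γ :=
  StarAlgebra.subset_adjoin ℂ _ (by simp)

theorem star_γ_mul_γ_mem : star γ * γ ∈ sphereSpan α γ :=
  StarAlgebra.subset_adjoin ℂ _ (by simp)

theorem γ_mul_star_α_mem : γ * star α ∈ sphereSpan α γ := by
  have h : star (α * star γ) ∈ sphereAlgebra α γ := star_mem (α_mul_star_γ_mem (α := α) (γ := γ))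
  rwa [star_mul, star_star] at h

/-- Of the four products of generators, `αα* = 1 - |q|²γ*γ` and `γγ* = γ*γ` use the relations; `αγ*`
is a generator and `γα*` the adjoint of one. -/
theorem genSpan_mul_star (h : SURelations q α γ) :
    genSpan α γ * genSpan (star α) (star γ) ≤ sphereSpan α γ := by
  rw [genSpan, genSpan, Submodule.span_mul_span, Submodule.span_le]
  rintro _ ⟨x, rfl | rfl, y, rfl | rfl, rfl⟩
  · change x * star x ∈ _
    rw [eq_sub_of_add_eq h.α_mul_star_α]
    exact sub_mem one_mem_sphereSpan (Submodule.smul_mem _ _ star_γ_mul_γ_mem)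
  · exact α_mul_star_γ_mem
  · exact γ_mul_star_α_mem
  · change x * star x ∈ _
    rw [h.γ_mul_star_γ]
    exact star_γ_mul_γ_mem

/-- In this order the mixed products `α*γ` and `γ*α` are multiples of `γα*` and `αγ*` by inverses of
`conj q` and `q`; this is where `q ≠ 0` enters. -/
theorem star_mul_genSpan (h : SURelations q α γ) (hq : q ≠ 0) :
    genSpan (star α) (star γ) * genSpan α γ ≤ sphereSpan α γ := by
  have hq' : conj q ≠ 0 := by simpa using hq
  rw [genSpan, genSpan, Submodule.span_mul_span, Submodule.span_le]
  rintro _ ⟨x, rfl | rfl, y, rfl | rfl, rfl⟩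
  · change star y * y ∈ _
    rw [eq_sub_of_add_eq h.star_α_mul_α]
    exact sub_mem one_mem_sphereSpan star_γ_mul_γ_mem
  · change star α * y ∈ _
    rw [← inv_smul_smul₀ hq' (star α * y), ← h.γ_mul_star_α]
    exact Submodule.smul_mem _ _ γ_mul_star_α_mem
  · change star γ * y ∈ _
    rw [← inv_smul_smul₀ hq (star γ * y), ← h.α_mul_star_γ]
    exact Submodule.smul_mem _ _ α_mul_star_γ_mem
  · exact star_γ_mul_γ_mem

/-- A subspace `P` satisfies `P S ≤ S P` for the *-algebra `S` generated by `α γ*` and `γ* γ`, if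
this holds for the generators of `S`. -/
theorem mul_sphereSpan_le {P : Submodule ℂ A}
    (h1 : ∀ x ∈ P, x * (α * star γ) ∈ sphereSpan α γ * P)
    (h2 : ∀ x ∈ P, x * (γ * star α) ∈ sphereSpan α γ * P)
    (h3 : ∀ x ∈ P, x * (star γ * γ) ∈ sphereSpan α γ * P) :
    P * sphereSpan α γ ≤ sphereSpan α γ * P := by
  -- The quantifier over `x` stays inside: for a product `s * t` the hypothesis on `t` is needed at
  -- new elements of `P`.
  suffices H : ∀ s ∈ sphereSpan α γ, ∀ x ∈ P, x * s ∈ sphereSpan α γ * P from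
    Submodule.mul_le.2 fun x hx s hs => H s hs x hx
  intro s hs
  -- As an algebra, `S` is generated by the two generators and their adjoints. Since `γ*γ` is
  -- self-adjoint, only `γα*` is new.
  have hs' : s ∈ Algebra.adjoin ℂ (({α * star γ, star γ * γ} : Set A) ∪
      star {α * star γ, star γ * γ}) := by
    rw [← StarAlgebra.adjoin_toSubalgebra]; exact hs
  clear hs
  induction hs' using Algebra.adjoin_induction with
  | mem s hs =>
    intro x hx
    rcases hs with (rfl | rfl) | hs | hs
    · exact h1 x hx
    · exact h3 x hx
    · rw [← star_star s, hs, star_mul, star_star]; exact h2 x hx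
    · rw [← star_star s, Set.mem_singleton_iff.1 hs, star_mul, star_star]; exact h3 x hx
  | algebraMap c =>
    intro x hx
    rw [← Algebra.commutes]
    exact Submodule.mul_mem_mul ((sphereAlgebra α γ).algebraMap_mem c) hx
  | add s t _ _ hs ht =>
    intro x hx
    rw [mul_add]
    exact add_mem (hs x hx) (ht x hx)
  | mul s t _ _ hs ht =>
    intro x hx
    rw [← mul_assoc]
    -- Expand `x * s` into terms `r * y` with `r` in `S` and `y` in `P`; then `y * t` lies in `S P`
    -- and `r` is absorbed by `S`.
    refine Submodule.mul_induction_on (C := fun y => y * t ∈ sphereSpan α γ * P) (hs x hx)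
      (fun r hr y hy => ?_) fun y z hy hz => ?_
    · have h := Submodule.mul_mem_mul hr (ht y hy)
      rw [← mul_assoc, ← mul_assoc] at h
      exact mul_le_mul' sphereSpan_mul_self le_rfl h
    · rw [add_mul]
      exact add_mem hy hz

/-- Each generator of `S` can be written, up to a scalar, as an element of `Q` times an element of
`P`. For `x` in `P` the first factor combines with `x` to an element of `PQ ≤ S`, which leaves `P`
on the right. -/
theorem genSpan_mul_sphereSpan (h : SURelations q α γ) :
    genSpan α γ * sphereSpan α γ ≤ sphereSpan α γ * genSpan α γ := by
  have hα : α ∈ genSpan α γ := Submodule.subset_span (by simp)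
  have hγ : γ ∈ genSpan α γ := Submodule.subset_span (by simp)
  have hα' : star α ∈ genSpan (star α) (star γ) := Submodule.subset_span (by simp)
  have hγ' : star γ ∈ genSpan (star α) (star γ) := Submodule.subset_span (by simp)
  have H : ∀ x ∈ genSpan α γ, ∀ y ∈ genSpan (star α) (star γ), ∀ z ∈ genSpan α γ,
      x * (y * z) ∈ sphereSpan α γ * genSpan α γ := fun x hx y hy z hz => by
    rw [← mul_assoc]
    exact Submodule.mul_mem_mul (genSpan_mul_star h (Submodule.mul_mem_mul hx hy)) hz
  refine mul_sphereSpan_le (fun x hx => ?_) (fun x hx => ?_) fun x hx => H x hx _ hγ' _ hγ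
  · rw [h.α_mul_star_γ, mul_smul_comm]
    exact Submodule.smul_mem _ _ (H x hx _ hγ' _ hα)
  · rw [h.γ_mul_star_α, mul_smul_comm]
    exact Submodule.smul_mem _ _ (H x hx _ hα' _ hγ)

/-- The mirror argument: here the generators are written as an element of `P` times an element of
`Q`, and `QP ≤ S` is used. -/
theorem genSpan_star_mul_sphereSpan (h : SURelations q α γ) (hq : q ≠ 0) :
    genSpan (star α) (star γ) * sphereSpan α γ ≤
      sphereSpan α γ * genSpan (star α) (star γ) := by
  have hα : α ∈ genSpan α γ := Submodule.subset_span (by simp)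
  have hγ : γ ∈ genSpan α γ := Submodule.subset_span (by simp)
  have hα' : star α ∈ genSpan (star α) (star γ) := Submodule.subset_span (by simp)
  have hγ' : star γ ∈ genSpan (star α) (star γ) := Submodule.subset_span (by simp)
  have H : ∀ x ∈ genSpan (star α) (star γ), ∀ y ∈ genSpan α γ,
      ∀ z ∈ genSpan (star α) (star γ),
      x * (y * z) ∈ sphereSpan α γ * genSpan (star α) (star γ) := fun x hx y hy z hz => by
    rw [← mul_assoc]
    exact Submodule.mul_mem_mul (star_mul_genSpan h hq (Submodule.mul_mem_mul hx hy)) hz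
  refine mul_sphereSpan_le (fun x hx => H x hx _ hα _ hγ') (fun x hx => H x hx _ hγ _ hα')
    fun x hx => ?_
  rw [← h.γ_mul_star_γ]
  exact H x hx _ hγ _ hγ'

theorem pow_mul_le_mul_pow {S P : Submodule ℂ A} (h : P * S ≤ S * P) (n : ℕ) :
    P ^ n * S ≤ S * P ^ n := by
  induction n with
  | zero => simp
  | succ n ih =>
    calc P ^ (n + 1) * S = P ^ n * (P * S) := by rw [pow_succ, mul_assoc]
      _ ≤ P ^ n * (S * P) := mul_le_mul' le_rfl h
      _ = P ^ n * S * P := (mul_assoc _ _ _).symm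
      _ ≤ S * P ^ n * P := mul_le_mul' ih le_rfl
      _ = _ := by rw [pow_succ, mul_assoc]

/-- If `Q P ≤ S` and `Q S ≤ S Q` for a multiplicatively closed subspace `S`, then
`S Qⁿ⁺¹ P ≤ S Qⁿ`. -/
theorem mul_pow_succ_mul_le {S P Q : Submodule ℂ A} (hS : S * S ≤ S) (hQP : Q * P ≤ S)
    (hQ : Q * S ≤ S * Q) (n : ℕ) : S * Q ^ (n + 1) * P ≤ S * Q ^ n :=
  calc S * Q ^ (n + 1) * P = S * (Q ^ n * (Q * P)) := by rw [pow_succ]; simp only [mul_assoc]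
    _ ≤ S * (Q ^ n * S) := mul_le_mul' le_rfl (mul_le_mul' le_rfl hQP)
    _ ≤ S * (S * Q ^ n) := mul_le_mul' le_rfl (pow_mul_le_mul_pow hQ n)
    _ = S * S * Q ^ n := (mul_assoc _ _ _).symm
    _ ≤ _ := mul_le_mul' hS le_rfl

/-- The sum of the subspaces `S Pⁿ` and `S Qⁿ`. -/
def gradedSpan (S P Q : Submodule ℂ A) : Submodule ℂ A :=
  (⨆ n : ℕ, S * P ^ n) ⊔ ⨆ n : ℕ, S * Q ^ n

/-- Right multiplication by `P` raises the degree by one: `S Pⁿ` goes to `S Pⁿ⁺¹`, and `S Qⁿ⁺¹` goes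
to `S Qⁿ` because one factor `Q` is absorbed. -/
theorem gradedSpan_mul_le {S P Q : Submodule ℂ A} (hS : S * S ≤ S) (hQP : Q * P ≤ S)
    (hQ : Q * S ≤ S * Q) : gradedSpan S P Q * P ≤ gradedSpan S P Q := by
  have hP : ∀ n, S * P ^ n * P ≤ gradedSpan S P Q := fun n => by
    rw [mul_assoc, ← pow_succ]
    exact le_sup_of_le_left (le_iSup (fun n => S * P ^ n) (n + 1))
  rw [gradedSpan, Submodule.sup_mul, Submodule.iSup_mul, Submodule.iSup_mul]
  refine sup_le (iSup_le hP) (iSup_le fun n => ?_)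
  cases n with
  -- The summands `S P⁰` and `S Q⁰` agree, so degree zero is covered by the `P` side.
  | zero => rw [pow_zero, ← pow_zero P]; exact hP 0
  | succ n =>
    exact (mul_pow_succ_mul_le hS hQP hQ n).trans
      (le_sup_of_le_right (le_iSup (fun n => S * Q ^ n) n))

/-- Allows `gradedSpan_mul_le` to be used for multiplication by `Q` with the roles exchanged. -/
theorem gradedSpan_comm (S P Q : Submodule ℂ A) : gradedSpan S P Q = gradedSpan S Q P :=
  sup_comm _ _

end Sphere

/-! ### Density of the graded polynomials. -/

namespace CSU

variable (q : ℂ)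

/-- The dense subspace of *-polynomials in `α` and `γ`, graded by the total degree. -/
def polySpan : Submodule ℂ (CSU q) :=
  gradedSpan (sphereSpan (α q) (γ q)) (genSpan (α q) (γ q)) (genSpan (star (α q)) (star (γ q)))

variable {q}

/-- Right multiplication by one letter is `gradedSpan_mul_le` for `P` or `Q`; longer words are
multiplied on letter by letter. Taking `x = 1` shows that `polySpan` contains all *-polynomials. -/
theorem mul_of_mem_polySpan (hq : q ≠ 0) (p : FreeStar SUGen) :
    ∀ x ∈ polySpan q, x * UnivCStar.of (suRel q) (isBoundedRel_suRel q) p ∈ polySpan q := by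
  have h := relations q
  have hP : ∀ x ∈ polySpan q, ∀ y ∈ genSpan (α q) (γ q), x * y ∈ polySpan q :=
    fun x hx y hy => gradedSpan_mul_le sphereSpan_mul_self (star_mul_genSpan h hq)
      (genSpan_star_mul_sphereSpan h hq) (Submodule.mul_mem_mul hx hy)
  have hQ : ∀ x ∈ polySpan q, ∀ y ∈ genSpan (star (α q)) (star (γ q)), x * y ∈ polySpan q :=
    fun x hx y hy => by
      rw [polySpan, gradedSpan_comm] at hx ⊢
      exact gradedSpan_mul_le sphereSpan_mul_self (genSpan_mul_star h)
        (genSpan_mul_sphereSpan h) (Submodule.mul_mem_mul hx hy)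
  induction p using FreeStar.induction with
  | h0 c =>
    intro x hx
    rw [AlgHomClass.commutes, ← Algebra.commutes, ← Algebra.smul_def]
    exact Submodule.smul_mem _ _ hx
  | h1 y =>
    intro x hx
    rw [UnivCStar.of_eq_eval, FreeStar.eval_letter]
    obtain ⟨g, b⟩ := y
    cases g <;> cases b
    · exact hP x hx (α q) (Submodule.subset_span (by simp))
    · exact hQ x hx (star (α q)) (Submodule.subset_span (by simp))
    · exact hP x hx (γ q) (Submodule.subset_span (by simp))
    · exact hQ x hx (star (γ q)) (Submodule.subset_span (by simp))
  | hm a b ha hb =>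
    intro x hx
    rw [map_mul, ← mul_assoc]
    exact hb _ (ha x hx)
  | ha a b ha hb =>
    intro x hx
    rw [map_add, mul_add]
    exact add_mem (ha x hx) (hb x hx)

theorem dense_polySpan (hq : q ≠ 0) : Dense (polySpan q : Set (CSU q)) := by
  refine UnivCStar.denseRange_of.mono ?_
  rintro _ ⟨p, rfl⟩
  have h1 : (1 : CSU q) ∈ polySpan q :=
    (le_sup_of_le_left (le_iSup_of_le 0 (by rw [pow_zero, mul_one])) :
      sphereSpan (α q) (γ q) ≤ polySpan q) one_mem_sphereSpan
  simpa using mul_of_mem_polySpan hq p 1 h1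

end CSU


/-! ### Positive functionals and the GNS representation. -/

section GelfandNaimark

open scoped ComplexOrder CStarAlgebra

variable {A : Type} [CStarAlgebra A]

/-- Positive functionals separate points from zero. -/
theorem exists_positive_ne_zero [PartialOrder A] [StarOrderedRing A] {a : A} (ha : a ≠ 0) :
    ∃ f : A →ₚ[ℂ] ℂ, f (star a * a) ≠ 0 := by
  have hb : 0 ≤ star a * a := star_mul_self_nonneg a
  have hb' : star a * a ≠ 0 := fun h => ha (CStarRing.star_mul_self_eq_zero_iff a |>.1 h)
  -- The point `-a*a` lies outside the closed cone of positive elements, so a real functional is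
  -- nonnegative on the cone and negative at that point.
  obtain ⟨g, hg, hgb⟩ := (ProperCone.positive ℝ A).hyperplane_separation_point
    (x₀ := -(star a * a)) (fun h => hb' (le_antisymm (neg_nonneg.1 h) hb))
  -- The separating functional is only real linear. Composed with the real part it vanishes at `i x`
  -- for self-adjoint `x`, so its complex extension agrees with `g` on self-adjoint elements and is
  -- positive.
  let r : Module.Dual ℝ A :=
    (g : A →ₗ[ℝ] ℝ) ∘ₗ (selfAdjoint.submodule ℝ A).subtype ∘ₗ (realPart : A →ₗ[ℝ] selfAdjoint A)
  have hr : ∀ x : A, IsSelfAdjoint x → Module.Dual.extendRCLike (𝕜 := ℂ) r x = (g x : ℂ) := by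
    intro x hx
    have h1 : r x = g x := by
      change g (realPart x : A) = g x
      rw [hx.coe_realPart]
    have h2 : r ((RCLike.I : ℂ) • x) = 0 := by
      change g (realPart (Complex.I • x) : A) = 0
      rw [realPart_I_smul, hx.imaginaryPart]
      simp
    rw [Module.Dual.extendRCLike_apply, h1, h2]
    simp
  refine ⟨PositiveLinearMap.mk₀ (Module.Dual.extendRCLike (𝕜 := ℂ) r) fun x hx => ?_, ?_⟩
  · rw [hr x (IsSelfAdjoint.of_nonneg hx)]
    exact_mod_cast hg x hx
  · change Module.Dual.extendRCLike (𝕜 := ℂ) r (star a * a) ≠ 0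
    rw [hr _ (IsSelfAdjoint.star_mul_self a)]
    rw [map_neg] at hgb
    exact_mod_cast ne_of_gt (neg_lt_zero.1 hgb)

/-- The representations of a C*-algebra on Hilbert spaces separate points. -/
theorem eq_zero_of_forall_rep (a : A)
    (h : ∀ (H : Type) [NormedAddCommGroup H] [InnerProductSpace ℂ H] [CompleteSpace H]
      (σ : A →⋆ₐ[ℂ] (H →L[ℂ] H)), σ a = 0) : a = 0 := by
  let _ := CStarAlgebra.spectralOrder A
  have _ := CStarAlgebra.spectralOrderedRing A
  by_contra ha
  obtain ⟨f, hf⟩ := exists_positive_ne_zero ha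
  -- Applied to the class of 1, the GNS operator of `a` gives the class of `a`, whose squared norm
  -- is `f(a*a)`.
  have h1 := DFunLike.congr_fun (h f.GNS f.gnsStarAlgHom) (f.toPreGNS 1 : f.GNS)
  have h2 : ‖f.toPreGNS a‖ = 0 := by
    have h3 : (f.toPreGNS a : f.GNS) = 0 := by simpa using h1
    rw [← UniformSpace.Completion.norm_coe, h3, norm_zero]
  refine hf ?_
  have h3 := f.preGNS_norm_sq (f.toPreGNS a)
  rw [h2] at h3
  simpa using h3.symm

end GelfandNaimark


/-! ### Representations of the minimal tensor product. -/

section Representations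

open UniformSpace

variable {A B : Type} [CStarAlgebra A] [CStarAlgebra B]
variable {H K : Type} [NormedAddCommGroup H] [InnerProductSpace ℂ H] [CompleteSpace H]
  [NormedAddCommGroup K] [InnerProductSpace ℂ K] [CompleteSpace K]

/-- A *-representation by bounded operators on a pre-Hilbert space extends to the completion. -/
def completeRep {F E : Type} [Ring F] [StarRing F] [Algebra ℂ F]
    [NormedAddCommGroup E] [InnerProductSpace ℂ E] (T : F →ₐ[ℂ] (E →L[ℂ] E))
    (hT : ∀ x ξ η, inner ℂ (T x ξ) η = inner ℂ ξ (T (star x) η)) :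
    F →⋆ₐ[ℂ] (Completion E →L[ℂ] Completion E) where
  toFun x := (T x).completion
  map_one' := by
    ext c
    induction c using Completion.induction_on with
    | hp => apply isClosed_eq <;> fun_prop
    | ih c => simp
  map_mul' x y := by
    ext c
    induction c using Completion.induction_on with
    | hp => apply isClosed_eq <;> fun_prop
    | ih c => simp
  map_zero' := by
    ext c
    induction c using Completion.induction_on with
    | hp => apply isClosed_eq <;> fun_prop
    | ih c => simp
  map_add' x y := by
    ext c
    induction c using Completion.induction_on with
    | hp => apply isClosed_eq <;> fun_prop
    | ih c => simp [Completion.coe_add]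
  commutes' r := by
    ext c
    induction c using Completion.induction_on with
    | hp => apply isClosed_eq <;> fun_prop
    | ih c => simp [Algebra.algebraMap_eq_smul_one]
  map_star' x := by
    -- The formal adjoint relation `hT` holds on a dense subspace and extends by continuity to the
    -- Hilbert space.
    refine (ContinuousLinearMap.eq_adjoint_iff _ _).2 fun ξ η => ?_
    induction ξ, η using Completion.induction_on₂ with
    | hp => apply isClosed_eq <;> fun_prop
    | ih ξ η => simp [hT]

theorem completeRep_coe {F E : Type} [Ring F] [StarRing F] [Algebra ℂ F]
    [NormedAddCommGroup E] [InnerProductSpace ℂ E] (T : F →ₐ[ℂ] (E →L[ℂ] E))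
    (hT : ∀ x ξ η, inner ℂ (T x ξ) η = inner ℂ ξ (T (star x) η)) (x : F) (ξ : E) :
    completeRep T hT x ξ = (T x ξ : E) :=
  ContinuousLinearMap.completion_apply_coe _ _

theorem norm_completeRep_le {F E : Type} [Ring F] [StarRing F] [Algebra ℂ F]
    [NormedAddCommGroup E] [InnerProductSpace ℂ E] (T : F →ₐ[ℂ] (E →L[ℂ] E))
    (hT : ∀ x ξ η, inner ℂ (T x ξ) η = inner ℂ ξ (T (star x) η)) (x : F) :
    ‖completeRep T hT x‖ ≤ ‖T x‖ := by
  refine ContinuousLinearMap.opNorm_le_bound _ (norm_nonneg _) fun ξ => ?_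
  induction ξ using Completion.induction_on with
  | hp => exact isClosed_le (by fun_prop) (by fun_prop)
  | ih ξ =>
    rw [completeRep_coe, Completion.norm_coe, Completion.norm_coe]
    exact (T x).le_opNorm ξ

/-- The Hilbert space tensor product. -/
abbrev HilbertTensor (H K : Type) [NormedAddCommGroup H] [InnerProductSpace ℂ H]
    [NormedAddCommGroup K] [InnerProductSpace ℂ K] : Type := Completion (H ⊗[ℂ] K)

/-- The representation `π ⊗ σ` of the minimal tensor product on the Hilbert space tensor product. -/
def MinTensor.rep (π : A →⋆ₐ[ℂ] (H →L[ℂ] H)) (σ : B →⋆ₐ[ℂ] (K →L[ℂ] K)) :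
    MinTensor A B →⋆ₐ[ℂ] (HilbertTensor H K →L[ℂ] HilbertTensor H K) :=
  CStarCompletion.lift (B := HilbertTensor H K →L[ℂ] HilbertTensor H K)
    (hp := isCStarSeminorm_minNorm) (completeRep (tensorRep π σ) (inner_tensorRep π σ)) fun x =>
    -- The minimal norm is the supremum of seminorms of exactly this form, so it dominates this one.
    (norm_completeRep_le _ _ x).trans (le_csSup (bddAbove_spatialSeminorms x)
      ⟨_, ⟨H, _, _, inferInstance, K, _, _, inferInstance, π, σ, rfl⟩, rfl⟩)

theorem MinTensor.rep_tmul (π : A →⋆ₐ[ℂ] (H →L[ℂ] H)) (σ : B →⋆ₐ[ℂ] (K →L[ℂ] K)) (a : A) (b : B)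
    (ξ : H) (η : K) :
    MinTensor.rep π σ (MinTensor.tmul a b) ((ξ ⊗ₜ[ℂ] η : H ⊗[ℂ] K) : HilbertTensor H K) =
      ((π a ξ ⊗ₜ[ℂ] σ b η : H ⊗[ℂ] K) : HilbertTensor H K) := by
  have h : MinTensor.rep π σ (MinTensor.tmul a b) =
      completeRep (tensorRep π σ) (inner_tensorRep π σ) (a ⊗ₜ b) :=
    CStarCompletion.lift_of (B := HilbertTensor H K →L[ℂ] HilbertTensor H K)
      (hp := isCStarSeminorm_minNorm) _ _ _
  rw [h, completeRep_coe, tensorRep_tmul, TensorProduct.mapL_tmul]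

/-- The evaluation at a point of the circle, as a one-dimensional representation. -/
def evalRep (w : Circle) : C(Circle, ℂ) →⋆ₐ[ℂ] (ℂ →L[ℂ] ℂ) where
  toFun f := f w • (1 : ℂ →L[ℂ] ℂ)
  map_one' := by ext; simp
  map_mul' f g := by ext; simp [mul_comm]
  map_zero' := by ext; simp
  map_add' f g := by ext; simp
  commutes' r := by ext; simp [Algebra.algebraMap_eq_smul_one]
  map_star' f := by rw [star_smul, star_one]; rfl

theorem evalRep_apply (w : Circle) (f : C(Circle, ℂ)) (c : ℂ) : evalRep w f c = f w * c := rfl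

end Representations

/-! ### A representation of the quantum torus with a vector fixed by `u`. -/

section TorusRep

/-- The Hilbert space of square summable functions on the integers. -/
abbrev SeqSpace : Type := lp (fun _ : ℤ => ℂ) 2

theorem memℓp_weightedPerm (e : ℤ ≃ ℤ) (c : ℤ → Circle) {f : ℤ → ℂ} (hf : Memℓp f 2) :
    Memℓp (fun n => (c n : ℂ) * f (e n)) 2 := by
  have h2 : (0 : ℝ) < (2 : ENNReal).toReal := by simp
  rw [memℓp_gen_iff h2] at hf ⊢
  have h := (e.summable_iff (f := fun n => ‖f n‖ ^ (2 : ENNReal).toReal)).2 hf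
  refine h.congr fun n => ?_
  rw [norm_mul, Circle.norm_coe, one_mul]
  rfl

/-- The unitary operator `(T f)(n) = c(n) f(e(n))`, for a permutation `e` and a function `c` with
values in the circle. -/
def weightedPerm (e : ℤ ≃ ℤ) (c : ℤ → Circle) : SeqSpace ≃ₗᵢ[ℂ] SeqSpace where
  toFun f := ⟨fun n => (c n : ℂ) * f (e n), memℓp_weightedPerm e c (lp.memℓp f)⟩
  invFun f := ⟨fun n => (((c (e.symm n))⁻¹ : Circle) : ℂ) * f (e.symm n),
    memℓp_weightedPerm e.symm (fun n => (c (e.symm n))⁻¹) (lp.memℓp f)⟩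
  map_add' f g := lp.ext (funext fun n => mul_add _ _ _)
  map_smul' r f := lp.ext (funext fun n => mul_left_comm _ _ _)
  left_inv f := lp.ext (funext fun n => by simp)
  right_inv f := lp.ext (funext fun n => by simp)
  norm_map' f := by
    have h2 : (0 : ℝ) < (2 : ENNReal).toReal := by simp
    rw [lp.norm_eq_tsum_rpow h2, lp.norm_eq_tsum_rpow h2]
    congr 1
    rw [← e.tsum_eq (fun n => ‖f n‖ ^ (2 : ENNReal).toReal)]
    refine tsum_congr fun n => ?_
    change ‖(c n : ℂ) * f (e n)‖ ^ _ = _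
    rw [norm_mul, Circle.norm_coe, one_mul]

/-- The unitary operators `(u f)(n) = μⁿ f(n)` and `(v f)(n) = f(n - 1)`. -/
def torusOp (μ : Circle) : TorusGen → (SeqSpace →L[ℂ] SeqSpace)
  | .u => weightedPerm (Equiv.refl ℤ) fun n => μ ^ n
  | .v => weightedPerm (Equiv.subRight 1) fun _ => 1

theorem satisfies_torusOp (μ : Circle) : Satisfies (torusRel (μ : ℂ)) (torusOp μ) := by
  have hU : ∀ T : SeqSpace ≃ₗᵢ[ℂ] SeqSpace,
      star (T : SeqSpace →L[ℂ] SeqSpace) * (T : SeqSpace →L[ℂ] SeqSpace) = 1 ∧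
        (T : SeqSpace →L[ℂ] SeqSpace) * star (T : SeqSpace →L[ℂ] SeqSpace) = 1 := fun T =>
    Unitary.mem_iff.1 (Unitary.linearIsometryEquiv.symm T).2
  rw [satisfies_torusRel]
  refine ⟨(hU _).1, (hU _).2, (hU _).1, (hU _).2, ?_⟩
  refine ContinuousLinearMap.ext fun f => lp.ext (funext fun n => ?_)
  -- `u v` multiplies the shifted function by `μⁿ` and `v u` by `μⁿ⁻¹`; the quotient is `μ`.
  change ((μ ^ n : Circle) : ℂ) * (((1 : Circle) : ℂ) * f (n - 1)) =
    (μ : ℂ) * (((1 : Circle) : ℂ) * (((μ ^ (n - 1) : Circle) : ℂ) * f (n - 1)))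
  rw [zpow_sub_one]
  simp only [Circle.coe_one, one_mul, Circle.coe_mul, ← mul_assoc]
  rw [mul_comm (μ : ℂ), mul_assoc _ (μ : ℂ), ← Circle.coe_mul μ, mul_inv_cancel,
    Circle.coe_one, mul_one]

/-- The representation of the quantum torus on the square summable functions on the integers. -/
def torusRep (μ : Circle) : QTorus μ →⋆ₐ[ℂ] (SeqSpace →L[ℂ] SeqSpace) :=
  UnivCStar.lift (torusOp μ) (satisfies_torusOp μ)

/-- The basis vector supported at `0`. -/
def vacuum : SeqSpace := lp.single 2 (0 : ℤ) (1 : ℂ)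

theorem norm_vacuum : ‖vacuum‖ = 1 := by
  rw [vacuum, lp.norm_single (by simp)]
  simp

/-- The vector `vacuum` is fixed by `u`. -/
theorem torusRep_u_vacuum (μ : Circle) : torusRep μ (QTorus.u μ) vacuum = vacuum := by
  have h : torusRep μ (QTorus.u μ) = torusOp μ .u := UnivCStar.lift_gen _ _ _
  rw [h]
  refine lp.ext (funext fun n => ?_)
  change ((μ ^ n : Circle) : ℂ) * vacuum n = vacuum n
  -- The weight `μⁿ` is 1 at `n = 0`, and `vacuum` vanishes elsewhere.
  by_cases hn : n = 0
  · subst hn; simp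
  · rw [vacuum, lp.single_apply_ne _ _ _ hn, mul_zero]

/-- A vector fixed by a unitary is fixed by its adjoint. This serves `γ*`, whose torus leg is `u*`.
-/
theorem torusRep_star_u_vacuum (μ : Circle) :
    torusRep μ (star (QTorus.u μ : QTorus μ)) vacuum = vacuum := by
  conv_lhs => rw [← torusRep_u_vacuum μ]
  rw [← mul_apply_eq_comp, ← map_mul, Unitary.coe_star_mul_self, map_one]
  rfl

end TorusRep


/-! ### The gauge automorphisms. -/

section Gauge

theorem circle_conj_mul_self (w : Circle) : conj (w : ℂ) * (w : ℂ) = 1 := by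
  rw [← Circle.coe_inv_eq_conj, ← Circle.coe_mul, inv_mul_cancel, Circle.coe_one]

/-- The defining relations are homogeneous for the total degree: three have degree 0 and `αγ = q̄γα`
has degree 2. -/
theorem SURelations.gauge {A : Type} [CStarAlgebra A] {q : ℂ} {α γ : A} (h : SURelations q α γ)
    (w : Circle) : SURelations q ((w : ℂ) • α) ((w : ℂ) • γ) := by
  have hw : conj (w : ℂ) * (w : ℂ) = 1 := circle_conj_mul_self w
  have hw' : (w : ℂ) * conj (w : ℂ) = 1 := by rw [mul_comm, hw]
  refine ⟨?_, ?_, ?_, ?_⟩ <;>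
    simp only [star_smul, RCLike.star_def, smul_mul_assoc, mul_smul_comm, smul_smul, hw, hw',
      one_smul]
  · exact h.star_α_mul_α
  · simpa only [mul_assoc, hw, hw', mul_one, one_smul] using h.α_mul_star_α
  · rw [h.α_mul_γ, smul_smul, mul_comm (conj q)]
  · exact h.γ_mul_star_γ

namespace CSU

variable {q : ℂ}

/-- The *-endomorphism of `C(SU_q(2))` with `α ↦ w α` and `γ ↦ w γ`. -/
def gauge (q : ℂ) (w : Circle) : CSU q →⋆ₐ[ℂ] CSU q := lift _ _ ((relations q).gauge w)

theorem gauge_α (w : Circle) : gauge q w (α q) = (w : ℂ) • α q := lift_α _ _ _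

theorem gauge_γ (w : Circle) : gauge q w (γ q) = (w : ℂ) • γ q := lift_γ _ _ _

theorem gauge_star_α (w : Circle) : gauge q w (star (α q)) = conj (w : ℂ) • star (α q) := by
  rw [map_star, gauge_α, star_smul]; rfl

theorem gauge_star_γ (w : Circle) : gauge q w (star (γ q)) = conj (w : ℂ) • star (γ q) := by
  rw [map_star, gauge_γ, star_smul]; rfl

variable {H K : Type} [NormedAddCommGroup H] [InnerProductSpace ℂ H] [CompleteSpace H]
  [NormedAddCommGroup K] [InnerProductSpace ℂ K] [CompleteSpace K]

/-- An operator which intertwines the actions of the generators and their adjoints under two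
representations of `C(SU_q(2))` is an intertwiner. -/
theorem intertwine (T : CSU q →⋆ₐ[ℂ] (H →L[ℂ] H)) (S : CSU q →⋆ₐ[ℂ] (K →L[ℂ] K)) (V : K →L[ℂ] H)
    (hα : ∀ k, T (α q) (V k) = V (S (α q) k))
    (hα' : ∀ k, T (star (α q)) (V k) = V (S (star (α q)) k))
    (hγ : ∀ k, T (γ q) (V k) = V (S (γ q) k))
    (hγ' : ∀ k, T (star (γ q)) (V k) = V (S (star (γ q)) k)) (x : CSU q) (k : K) :
    T x (V k) = V (S x k) := by
  refine UnivCStar.denseRange_of.induction_on (p := fun x => T x (V k) = V (S x k)) x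
    (isClosed_eq ((continuous_hom T).clm_apply continuous_const)
      (V.continuous.comp ((continuous_hom S).clm_apply continuous_const))) fun p => ?_
  -- The vector varies, since for a product the second factor first moves `k` to `S b k`. Adjoint
  -- letters need their own hypotheses, because an intertwiner for an operator need not intertwine
  -- its adjoint.
  induction p using FreeStar.induction generalizing k with
  | h0 c => simp [Algebra.algebraMap_eq_smul_one]
  | h1 y =>
    rw [UnivCStar.of_eq_eval, FreeStar.eval_letter]
    obtain ⟨g, b⟩ := y
    cases g <;> cases b
    · exact hα k
    · exact hα' k
    · exact hγ k
    · exact hγ' k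
  | hm a b ha hb => rw [map_mul, map_mul, map_mul, mul_apply_eq_comp, hb, ha]; rfl
  | ha a b ha hb =>
    rw [map_add, map_add, map_add, add_apply, add_apply, ha, hb, map_add]

end CSU

end Gauge

/-! ### The quotient sphere and gauge invariance. -/

section Invariance

open CSU UniformSpace

variable {q : ℂ} {K : Type} [NormedAddCommGroup K] [InnerProductSpace ℂ K]

/-- The representation of `C(𝕋²_ζ) ⊗ C(SU_q(2)) ⊗ C(𝕋)` determined by a representation of
`C(SU_q(2))` and a point of the circle. -/
def ambientRep [CompleteSpace K] (ζ : Circle) (σ : CSU q →⋆ₐ[ℂ] (K →L[ℂ] K)) (w : Circle) :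
    Ambient ζ (CSU q) C(Circle, ℂ) →⋆ₐ[ℂ]
      (HilbertTensor (HilbertTensor SeqSpace K) ℂ →L[ℂ]
        HilbertTensor (HilbertTensor SeqSpace K) ℂ) :=
  MinTensor.rep (MinTensor.rep (torusRep ζ) σ) (evalRep w)

/-- The embedding `k ↦ vacuum ⊗ k ⊗ 1`. -/
def vacuumEmbedding (K : Type) [NormedAddCommGroup K] [InnerProductSpace ℂ K] :
    K →L[ℂ] HilbertTensor (HilbertTensor SeqSpace K) ℂ :=
  Completion.toComplL ∘L (TensorProduct.mkL ℂ (HilbertTensor SeqSpace K) ℂ).flip 1 ∘L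
    Completion.toComplL ∘L TensorProduct.mkL ℂ SeqSpace K vacuum

theorem vacuumEmbedding_apply (k : K) : vacuumEmbedding K k =
    (((((vacuum ⊗ₜ[ℂ] k : SeqSpace ⊗[ℂ] K) : HilbertTensor SeqSpace K) ⊗ₜ[ℂ] (1 : ℂ) :
      HilbertTensor SeqSpace K ⊗[ℂ] ℂ)) : HilbertTensor (HilbertTensor SeqSpace K) ℂ) := rfl

/-- Provides the injectivity by which equalities pass from the tensor product back to `K`. -/
theorem norm_vacuumEmbedding (k : K) : ‖vacuumEmbedding K k‖ = ‖k‖ := by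
  rw [vacuumEmbedding_apply, Completion.norm_coe, TensorProduct.norm_tmul, Completion.norm_coe,
    TensorProduct.norm_tmul, norm_vacuum, norm_one, mul_one, one_mul]

/-- A torus leg fixing `vacuum` becomes invisible, and the last leg becomes a scalar. It is applied
with `t` equal to 1, `u` or `u*`. -/
theorem ambientRep_tmul [CompleteSpace K] (ζ : Circle) (σ : CSU q →⋆ₐ[ℂ] (K →L[ℂ] K))
    (w : Circle) {t : QTorus ζ} (ht : torusRep ζ t vacuum = vacuum) (x : CSU q) (f : C(Circle, ℂ)) (k : K) :
    ambientRep ζ σ w (MinTensor.tmul (MinTensor.tmul t x) f) (vacuumEmbedding K k) =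
      vacuumEmbedding K (f w • σ x k) := by
  rw [vacuumEmbedding_apply, ambientRep, MinTensor.rep_tmul, MinTensor.rep_tmul, ht, map_smul,
    vacuumEmbedding_apply, evalRep_apply, ← smul_eq_mul, TensorProduct.tmul_smul,
    Completion.coe_smul]

variable (q) (hq : q ≠ 0)

theorem homogeneous_trivial {A : Type} [CStarAlgebra A] (x : A) :
    (CircleAction.trivial A).IsHomogeneous 0 x := by
  rw [CircleAction.IsHomogeneous, zPow_zero]; rfl

/-- The term of `Δ(α)` containing `j₂(γ)` dies under `π`. The torus leg is 1 because `α` and all of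
`C(𝕋)` have degree 0; for `γ`, of degree 1, it is `u`. -/
theorem incl_rightAction_α : Braided.incl _ _ _ (rightAction q hq (α q)) =
    MinTensor.tmul (MinTensor.tmul 1 (α q)) zGen := by
  have h1 : piHom q (α q) = zGen := CSU.lift_α _ _ _
  have h2 : piHom q (γ q) = 0 := CSU.lift_γ _ _ _
  rw [rightAction, StarAlgHom.comp_apply, comul_α, map_sub, map_smul, Braided.map_ι₁_mul_ι₂,
    Braided.map_ι₁_mul_ι₂, h1, h2, map_zero, mul_zero, smul_zero, sub_zero, map_mul,
    Braided.incl_ι₁, Braided.incl_ι₂, StarAlgHom.coe_id, id_eq, j₁_of_homogeneous _ homogeneous_α,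
    j₂_of_homogeneous _ (homogeneous_trivial _), MinTensor.tmul_mul_tmul, MinTensor.tmul_mul_tmul]
  simp

theorem incl_rightAction_γ : Braided.incl _ _ _ (rightAction q hq (γ q)) =
    MinTensor.tmul (MinTensor.tmul (QTorus.u (zeta q hq) : QTorus (zeta q hq)) (γ q)) zGen := by
  have h1 : piHom q (α q) = zGen := CSU.lift_α _ _ _
  have h2 : piHom q (γ q) = 0 := CSU.lift_γ _ _ _
  rw [rightAction, StarAlgHom.comp_apply, comul_γ, map_add, Braided.map_ι₁_mul_ι₂,
    Braided.map_ι₁_mul_ι₂, h1, h2, map_zero, mul_zero, add_zero, map_mul,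
    Braided.incl_ι₁, Braided.incl_ι₂, StarAlgHom.coe_id, id_eq, j₁_of_homogeneous _ homogeneous_γ,
    j₂_of_homogeneous _ (homogeneous_trivial _), MinTensor.tmul_mul_tmul, MinTensor.tmul_mul_tmul]
  simp

variable {q}

/-- Evaluating the last leg at `w` turns the factor `z` of both generators into `w`, which is what
`gauge q w` does. By `intertwine`, generators and adjoints suffice. -/
theorem ambientRep_rightAction [CompleteSpace K] (σ : CSU q →⋆ₐ[ℂ] (K →L[ℂ] K)) (w : Circle)
    (x : CSU q) (k : K) :
    ambientRep _ σ w (Braided.incl _ _ _ (rightAction q hq x)) (vacuumEmbedding K k) =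
      vacuumEmbedding K (σ (gauge q w x) k) := by
  have h1 : torusRep (zeta q hq) 1 vacuum = vacuum := by rw [map_one]; rfl
  have hz : zGen w = (w : ℂ) := rfl
  have hz' : (star zGen : C(Circle, ℂ)) w = conj (w : ℂ) := rfl
  refine intertwine (((ambientRep _ σ w).comp (Braided.incl _ _ _)).comp (rightAction q hq))
    (σ.comp (gauge q w)) (vacuumEmbedding K) (fun k => ?_) (fun k => ?_) (fun k => ?_)
    (fun k => ?_) x k
  · simp only [StarAlgHom.comp_apply]
    rw [incl_rightAction_α, ambientRep_tmul _ _ _ h1, gauge_α, map_smul σ, hz]; rfl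
  · simp only [StarAlgHom.comp_apply]
    rw [map_star (rightAction q hq), map_star (Braided.incl _ _ _), incl_rightAction_α,
      MinTensor.star_tmul, MinTensor.star_tmul, star_one, ambientRep_tmul _ _ _ h1, gauge_star_α,
      map_smul σ, hz']; rfl
  · simp only [StarAlgHom.comp_apply]
    rw [incl_rightAction_γ, ambientRep_tmul _ _ _ (torusRep_u_vacuum _), gauge_γ, map_smul σ, hz]
    rfl
  · simp only [StarAlgHom.comp_apply]
    rw [map_star (rightAction q hq), map_star (Braided.incl _ _ _), incl_rightAction_γ,
      MinTensor.star_tmul, MinTensor.star_tmul, ambientRep_tmul _ _ _ (torusRep_star_u_vacuum _),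
      gauge_star_γ, map_smul σ, hz']; rfl

theorem j₁_α (ζ : Circle) : j₁ ζ (action q) C(Circle, ℂ) (α q) =
    MinTensor.tmul (MinTensor.tmul 1 (α q)) 1 := by
  rw [j₁_of_homogeneous _ homogeneous_α]; simp

theorem j₁_γ (ζ : Circle) : j₁ ζ (action q) C(Circle, ℂ) (γ q) =
    MinTensor.tmul (MinTensor.tmul (QTorus.u ζ : QTorus ζ) (γ q)) 1 := by
  rw [j₁_of_homogeneous _ homogeneous_γ]; simp

/-- The counterpart for `a ⊗ 1`: the last leg is 1, so the point `w` leaves no trace. -/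
theorem ambientRep_j₁ [CompleteSpace K] (ζ : Circle) (σ : CSU q →⋆ₐ[ℂ] (K →L[ℂ] K))
    (w : Circle) (x : CSU q) (k : K) : ambientRep ζ σ w (j₁ ζ (action q) C(Circle, ℂ) x) (vacuumEmbedding K k) =
      vacuumEmbedding K (σ x k) := by
  have h1 : torusRep ζ 1 vacuum = vacuum := by rw [map_one]; rfl
  refine intertwine ((ambientRep ζ σ w).comp (j₁ ζ (action q) C(Circle, ℂ))) σ
    (vacuumEmbedding K) (fun k => ?_) (fun k => ?_) (fun k => ?_) (fun k => ?_) x k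
  · simp only [StarAlgHom.comp_apply]
    rw [j₁_α, ambientRep_tmul _ _ _ h1, ContinuousMap.one_apply, one_smul]
  · simp only [StarAlgHom.comp_apply]
    rw [map_star (j₁ ζ (action q) C(Circle, ℂ)), j₁_α, MinTensor.star_tmul, MinTensor.star_tmul,
      star_one, star_one, ambientRep_tmul _ _ _ h1, ContinuousMap.one_apply, one_smul]
  · simp only [StarAlgHom.comp_apply]
    rw [j₁_γ, ambientRep_tmul _ _ _ (torusRep_u_vacuum _), ContinuousMap.one_apply, one_smul]
  · simp only [StarAlgHom.comp_apply]
    rw [map_star (j₁ ζ (action q) C(Circle, ℂ)), j₁_γ, MinTensor.star_tmul, MinTensor.star_tmul,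
      star_one, ambientRep_tmul _ _ _ (torusRep_star_u_vacuum _), ContinuousMap.one_apply, one_smul]

/-- The elements of `C(S²_q)` are invariant under the gauge automorphisms. -/
theorem gauge_eq_of_mem_quotientSphere {a : CSU q} (ha : a ∈ quotientSphere q hq) (w : Circle) :
    gauge q w a = a := by
  have ha' : rightAction q hq a = Braided.ι₁ _ _ _ a := ha
  rw [← sub_eq_zero]
  refine eq_zero_of_forall_rep _ fun K _ _ _ σ => ContinuousLinearMap.ext fun k => ?_
  have h1 := ambientRep_rightAction hq σ w a k
  -- The defining equation of the sphere identifies the two computations: `σ a k` and `σ (gauge q w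
  -- a) k` have the same image under an isometric embedding.
  rw [ha', Braided.incl_ι₁, ambientRep_j₁] at h1
  rw [map_sub, sub_apply, zero_apply, ← norm_eq_zero, ← norm_vacuumEmbedding,
    map_sub, h1, sub_self, norm_zero]

/-- The algebra generated by `α γ*` and `γ* γ` is contained in `C(S²_q)`. -/
theorem sphereAlgebra_le_quotientSphere : sphereAlgebra (α q) (γ q) ≤ quotientSphere q hq := by
  have hz : star zGen * zGen = 1 := by
    rw [← zPow_one, star_zPow, ← zPow_add, neg_add_cancel, zPow_zero]
  have hz' : zGen * star zGen = 1 := by rw [mul_comm, hz]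
  -- An equalizer is a *-subalgebra, so the two generators suffice. In each, `z` meets `z*` and
  -- cancels, while the torus legs are already those of `j₁`.
  refine StarAlgebra.adjoin_le ?_
  rintro _ (rfl | rfl)
  · refine Braided.incl_injective _ _ ?_
    change Braided.incl _ _ _ (rightAction q hq (α q * star (γ q))) =
      Braided.incl _ _ _ (Braided.ι₁ _ _ _ (α q * star (γ q)))
    rw [map_mul (rightAction q hq), map_star (rightAction q hq), map_mul, map_star,
      incl_rightAction_α, incl_rightAction_γ, Braided.incl_ι₁,
      map_mul (j₁ (zeta q hq) (action q) C(Circle, ℂ)),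
      map_star (j₁ (zeta q hq) (action q) C(Circle, ℂ)), j₁_α, j₁_γ]
    simp only [MinTensor.star_tmul, MinTensor.tmul_mul_tmul, hz', star_one, mul_one]
  · refine Braided.incl_injective _ _ ?_
    change Braided.incl _ _ _ (rightAction q hq (star (γ q) * γ q)) =
      Braided.incl _ _ _ (Braided.ι₁ _ _ _ (star (γ q) * γ q))
    rw [map_mul (rightAction q hq), map_star (rightAction q hq), map_mul, map_star,
      incl_rightAction_γ, Braided.incl_ι₁,
      map_mul (j₁ (zeta q hq) (action q) C(Circle, ℂ)),
      map_star (j₁ (zeta q hq) (action q) C(Circle, ℂ)), j₁_γ]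
    simp only [MinTensor.star_tmul, MinTensor.tmul_mul_tmul, hz, star_one, mul_one]

theorem isClosed_quotientSphere : IsClosed (quotientSphere q hq : Set (CSU q)) :=
  isClosed_eq (continuous_hom (rightAction q hq)) (continuous_hom (Braided.ι₁ _ _ _))

end Invariance

/-! ### Averaging over roots of unity. -/

section Averaging

open CSU Filter

variable {q : ℂ}

theorem gauge_sphereSpan (w : Circle) {x : CSU q} (hx : x ∈ sphereSpan (α q) (γ q)) :
    gauge q w x = x := by
  have hw : conj (w : ℂ) * (w : ℂ) = 1 := circle_conj_mul_self w
  have h : sphereAlgebra (α q) (γ q) ≤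
      StarAlgHom.equalizer (gauge q w) (StarAlgHom.id ℂ (CSU q)) := by
    refine StarAlgebra.adjoin_le ?_
    rintro _ (rfl | rfl)
    · change gauge q w (α q * star (γ q)) = α q * star (γ q)
      rw [map_mul, gauge_α, gauge_star_γ, smul_mul_smul_comm, mul_comm (w : ℂ), hw, one_smul]
    · change gauge q w (star (γ q) * γ q) = star (γ q) * γ q
      rw [map_mul, gauge_γ, gauge_star_γ, smul_mul_smul_comm, hw, one_smul]
  exact h hx

/-- Eigenvalues of a multiplicative map multiply. With eigenvalue 1 on `S`, `w` on `P` and `conj w`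
on `Q`, this gives the action of `gauge` on every graded piece. -/
theorem map_mul_eq_smul {A : Type} [CStarAlgebra A] (g : A →⋆ₐ[ℂ] A) {M N : Submodule ℂ A}
    {c d : ℂ} (hM : ∀ x ∈ M, g x = c • x) (hN : ∀ x ∈ N, g x = d • x) {x : A} (hx : x ∈ M * N) :
    g x = (c * d) • x := by
  refine Submodule.mul_induction_on hx (fun m hm n hn => ?_) fun x y hx hy => ?_
  · rw [map_mul, hM m hm, hN n hn, smul_mul_smul_comm]
  · rw [map_add, hx, hy, smul_add]

theorem map_pow_eq_smul {A : Type} [CStarAlgebra A] (g : A →⋆ₐ[ℂ] A) {M : Submodule ℂ A}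
    {c : ℂ} (hM : ∀ x ∈ M, g x = c • x) (n : ℕ) : ∀ x ∈ M ^ n, g x = c ^ n • x := by
  induction n with
  | zero =>
    intro x hx
    rw [pow_zero] at hx
    obtain ⟨r, rfl⟩ := Submodule.mem_one.1 hx
    rw [AlgHomClass.commutes, pow_zero, one_smul]
  | succ n ih =>
    intro x hx
    rw [pow_succ] at hx ⊢
    exact map_mul_eq_smul g ih hM hx

theorem map_genSpan_eq_smul {A : Type} [CStarAlgebra A] (g : A →⋆ₐ[ℂ] A) {a b : A} {c : ℂ}
    (ha : g a = c • a) (hb : g b = c • b) : ∀ x ∈ genSpan a b, g x = c • x := by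
  intro x hx
  induction hx using Submodule.span_induction with
  | mem x hx =>
    rcases hx with rfl | rfl
    · exact ha
    · exact hb
  | zero => rw [map_zero, smul_zero]
  | add x y _ _ hx hy => rw [map_add, hx, hy, smul_add]
  | smul r x _ hx => rw [map_smul, hx, smul_comm]

theorem gauge_sphereSpan_mul_pow (w : Circle) (n : ℕ) {x : CSU q}
    (hx : x ∈ sphereSpan (α q) (γ q) * genSpan (α q) (γ q) ^ n) :
    gauge q w x = ((w : ℂ) ^ n) • x := by
  have h := map_mul_eq_smul (gauge q w) (c := 1)
    (fun x hx => by rw [gauge_sphereSpan w hx, one_smul])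
    (map_pow_eq_smul _ (map_genSpan_eq_smul _ (gauge_α w) (gauge_γ w)) n) hx
  rwa [one_mul] at h

theorem gauge_sphereSpan_mul_star_pow (w : Circle) (n : ℕ) {x : CSU q}
    (hx : x ∈ sphereSpan (α q) (γ q) * genSpan (star (α q)) (star (γ q)) ^ n) :
    gauge q w x = (conj (w : ℂ) ^ n) • x := by
  have h := map_mul_eq_smul (gauge q w) (c := 1)
    (fun x hx => by rw [gauge_sphereSpan w hx, one_smul])
    (map_pow_eq_smul _ (map_genSpan_eq_smul _ (gauge_star_α w) (gauge_star_γ w)) n) hx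
  rwa [one_mul] at h

/-- The standard primitive `N`-th root of unity. -/
def rootOfUnity (N : ℕ) : Circle := Circle.exp (2 * Real.pi / N)

theorem isPrimitiveRoot_rootOfUnity {N : ℕ} (hN : N ≠ 0) :
    IsPrimitiveRoot (rootOfUnity N : ℂ) N := by
  have h := Complex.isPrimitiveRoot_exp N hN
  rw [rootOfUnity, Circle.coe_exp]
  convert h using 2
  push_cast
  ring

/-- The average of the gauge automorphisms over the `N`-th roots of unity. -/
def gaugeMean (q : ℂ) (N : ℕ) : CSU q →ₗ[ℂ] CSU q :=
  (N : ℂ)⁻¹ • ∑ k ∈ Finset.range N,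
    ((gauge q (rootOfUnity N ^ k) : CSU q →ₐ[ℂ] CSU q) : CSU q →ₗ[ℂ] CSU q)

theorem gaugeMean_apply (N : ℕ) (x : CSU q) : gaugeMean q N x =
    (N : ℂ)⁻¹ • ∑ k ∈ Finset.range N, gauge q (rootOfUnity N ^ k) x := by
  simp [gaugeMean, LinearMap.sum_apply]

theorem gaugeMean_of_invariant {N : ℕ} (hN : N ≠ 0) {x : CSU q} (hx : ∀ w, gauge q w x = x) :
    gaugeMean q N x = x := by
  have hN' : (N : ℂ) ≠ 0 := by exact_mod_cast hN
  rw [gaugeMean_apply, Finset.sum_congr rfl fun k _ => hx _, Finset.sum_const, Finset.card_range,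
    ← Nat.cast_smul_eq_nsmul ℂ, inv_smul_smul₀ hN']

/-- A mean of *-homomorphisms, each of which is contractive. -/
theorem norm_gaugeMean_le {N : ℕ} (hN : N ≠ 0) (x : CSU q) : ‖gaugeMean q N x‖ ≤ ‖x‖ := by
  have hN' : (N : ℝ) ≠ 0 := by exact_mod_cast hN
  have h : ‖∑ k ∈ Finset.range N, gauge q (rootOfUnity N ^ k) x‖ ≤ N * ‖x‖ := by
    refine (norm_sum_le_of_le _ fun k _ =>
      NonUnitalStarAlgHom.norm_apply_le (gauge q (rootOfUnity N ^ k)) x).trans_eq ?_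
    rw [Finset.sum_const, Finset.card_range, nsmul_eq_mul]
  rw [gaugeMean_apply, norm_smul, norm_inv, Complex.norm_natCast]
  calc (N : ℝ)⁻¹ * _ ≤ (N : ℝ)⁻¹ * (N * ‖x‖) := mul_le_mul_of_nonneg_left h (by positivity)
    _ = ‖x‖ := inv_mul_cancel_left₀ hN' _

/-- The mean is a multiple of the geometric sum `1 + z + ⋯ + zᴺ⁻¹`, which vanishes for an `N`-th
root of unity other than 1. -/
theorem gaugeMean_eq_zero {N : ℕ} {x : CSU q} {z : ℂ} (hz : z ≠ 1) (hzN : z ^ N = 1)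
    (hx : ∀ k, gauge q (rootOfUnity N ^ k) x = z ^ k • x) : gaugeMean q N x = 0 := by
  rw [gaugeMean_apply, Finset.sum_congr rfl fun k _ => hx k, ← Finset.sum_smul, geom_sum_eq hz,
    hzN, sub_self, zero_div, zero_smul, smul_zero]

/-- The average of a *-polynomial over the `N`-th roots of unity is its component of degree zero,
for large `N`. -/
theorem eventually_gaugeMean_mem {x : CSU q} (hx : x ∈ polySpan q) :
    ∀ᶠ N in atTop, gaugeMean q N x ∈ sphereSpan (α q) (γ q) := by
  -- How large `N` must be depends on the degrees in `x`. The elements for which some bound exists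
  -- form a subspace, so each graded piece can be treated alone.
  let W : Submodule ℂ (CSU q) :=
    { carrier := {x | ∀ᶠ N in atTop, gaugeMean q N x ∈ sphereSpan (α q) (γ q)}
      zero_mem' := Eventually.of_forall fun N => by rw [map_zero]; exact zero_mem _
      add_mem' := fun hx hy => by
        filter_upwards [hx, hy] with N h h'
        rw [map_add]
        exact add_mem h h'
      smul_mem' := fun c x hx => by
        filter_upwards [hx] with N h
        rw [map_smul]
        exact Submodule.smul_mem _ _ h }
  have h0 : ∀ x ∈ sphereSpan (α q) (γ q), x ∈ W := fun x hx => by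
    filter_upwards [eventually_ne_atTop 0] with N hN
    rw [gaugeMean_of_invariant hN fun w => gauge_sphereSpan w hx]
    exact hx
  refine (sup_le (iSup_le fun n x hx => ?_) (iSup_le fun n x hx => ?_) : polySpan q ≤ W) hx
  · rcases eq_or_ne n 0 with rfl | hn
    · rw [pow_zero, mul_one] at hx
      exact h0 x hx
    -- For `0 < n < N` the `n`-th power of a primitive `N`-th root of unity is not 1, so the piece
    -- of degree `n` averages to zero.
    filter_upwards [eventually_gt_atTop n] with N hN
    have hr := isPrimitiveRoot_rootOfUnity (N := N) (by omega)
    rw [gaugeMean_eq_zero (z := (rootOfUnity N : ℂ) ^ n) (hr.pow_ne_one_of_pos_of_lt hn hN)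
      (by rw [pow_right_comm, hr.pow_eq_one, one_pow]) fun k => ?_]
    · exact zero_mem _
    · rw [gauge_sphereSpan_mul_pow _ n hx, Circle.coe_pow, pow_right_comm]
  · rcases eq_or_ne n 0 with rfl | hn
    · rw [pow_zero, mul_one] at hx
      exact h0 x hx
    filter_upwards [eventually_gt_atTop n] with N hN
    -- On the adjoint side the eigenvalue is a power of the conjugate root, which is primitive as
    -- well.
    have hr := (isPrimitiveRoot_rootOfUnity (N := N) (by omega)).map_of_injective
      (f := starRingEnd ℂ) (RingHom.injective _)
    rw [gaugeMean_eq_zero (z := conj (rootOfUnity N : ℂ) ^ n) (hr.pow_ne_one_of_pos_of_lt hn hN)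
      (by rw [pow_right_comm, hr.pow_eq_one, one_pow]) fun k => ?_]
    · exact zero_mem _
    · rw [gauge_sphereSpan_mul_star_pow _ n hx, Circle.coe_pow, map_pow, pow_right_comm]

/-- The gauge invariant elements are limits of elements of the algebra generated by `α γ*` and
`γ* γ`. -/
theorem mem_closure_of_invariant (hq : q ≠ 0) {a : CSU q} (ha : ∀ w, gauge q w a = a) :
    a ∈ closure (sphereAlgebra (α q) (γ q) : Set (CSU q)) := by
  refine Metric.mem_closure_iff.2 fun ε hε => ?_
  obtain ⟨p, hp, hap⟩ := Metric.mem_closure_iff.1 (dense_polySpan hq a) ε hε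
  obtain ⟨N, hNp, hN⟩ := ((eventually_gaugeMean_mem hp).and (eventually_ne_atTop 0)).exists
  refine ⟨gaugeMean q N p, hNp, ?_⟩
  -- Replacing `a` by its own mean makes the distance to the mean of `p` equal to the norm of the
  -- mean of `a - p`, which is at most the norm of `a - p`.
  conv_lhs => rw [← gaugeMean_of_invariant hN ha]
  rw [dist_eq_norm, ← map_sub]
  rw [dist_eq_norm] at hap
  exact (norm_gaugeMean_le hN _).trans_lt hap

end Averaging

end BraidedSU2

end

theorem mainTheorem4 (q : ℂ) (hq₀ : 0 < ‖q‖) (hq₁ : ‖q‖ < 1) :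
    BraidedSU2.quotientSphere q (norm_pos_iff.1 hq₀) =
      (StarAlgebra.adjoin ℂ
        {BraidedSU2.CSU.α q * star (BraidedSU2.CSU.γ q),
          star (BraidedSU2.CSU.γ q) * BraidedSU2.CSU.γ q}).topologicalClosure ∧
    BraidedSU2.PodlesRelations ‖q‖ (star (BraidedSU2.CSU.γ q) * BraidedSU2.CSU.γ q)
      (BraidedSU2.CSU.α q * star (BraidedSU2.CSU.γ q)) := by
  have hq : q ≠ 0 := norm_pos_iff.1 hq₀
  refine ⟨le_antisymm (fun a ha => ?_) ?_, (BraidedSU2.CSU.relations q).podlesRelations⟩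
  · exact BraidedSU2.mem_closure_of_invariant hq
      (BraidedSU2.gauge_eq_of_mem_quotientSphere hq ha)
  · exact StarSubalgebra.topologicalClosure_minimal
      (BraidedSU2.sphereAlgebra_le_quotientSphere hq) (BraidedSU2.isClosed_quotientSphere hq)
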